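/- **Setting.** Let $p,q\ge 0$ and let $\mathcal F=\mathbb C\Omega\oplus\bigoplus_{n\ge1}L^2(\mathbb R_+^n)$ be the free Fock space over $L^2(\mathbb R_+)$, with vacuum state $\varphi(X)=\langle X\Omega,\Omega\rangle$. Let $w(s,t)=p$ if $0<s<t$, $w(s,t)=q$ if $0<t<s$, and $w(s,t)=1$ otherwise. For $f\in L^2(\mathbb R_+)$ the $(p,q)$-creation operator $a(f)$ is the bounded operator on $\mathcal F$ with $a(f)\Omega=f$ and $$(a(f)F)(t_1,\dots,t_{n+1})=f(t_1)\sqrt{w(t_1,t_2)}\,F(t_2,\dots,t_{n+1}),\qquad F\in L^2(\mathbb R_+^n),\ n\ge1 .$$ For $t\ge 0$ put $a_t=a(\chi_{[0,t]})$, let $a_t^*$ be its adjoint, and let $m_t$ be the bounded operator with $m_t\Omega=0$ and $(m_tF)(t_1,\dots,t_n)=\chi_{[0,t]}(t_1)F(t_1,\dots,t_n)$ for $F\in L^2(\mathbb R_+^n)$, $n\ge1$. The $(p,q)$-Poisson process is $$\gamma_t=a_t+a_t^*+a_t^*a_t+m_t .$$ Let $\mathcal{NC}_n$ be the set of non-crossing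 partitions of $[n]=\{1,\dots,n\}$, and let $\mathcal{ONC}_n$ be the set of ordered non-crossing partitions, i.e. sequences $P=(P_1,\dots,P_b)$ enumerating the blocks of some $\pi\in\mathcal{NC}_n$; $b(P)=b(\pi)=b$ is the number of blocks. A block $A$ is inner with respect to a block $B\neq A$ if there are $x,y\in B$ with $x<c<y$ for all $c\in A$; if moreover no block $C$ of the partition satisfies that $A$ is inner with respect to $C$ and $C$ is inner with respect to $B$, then $A$ is an inner neighbor of $B$. Let $e(P)$ (disorders) be the number of pairs $i<j$ such that $P_i$ is an inner neighbor of $P_j$, let $e'(P)$ (orders) be the number of pairs $i<j$ such that $P_j$ is an inner neighbor of $P_i$, and let $w(P)=p^{e(P)}q^{e'(P)}$ (with $0^0=1$). Let $\mathcal{MNC}_n$ be the set of monotone non-crossing partitions: those $P\in\mathcal{ONC}_n$ such that $i<j$ whenever $P_j$ is inner with respect to $P_i$. **Theorem 5.1.** For all $p,q\ge0$ and $t\ge 0$ we have $\varphi(\gamma_t^0)=1$ and, for every integer $n\ge 0$, $$\varphi(\gamma_t^n)=\sum_{P\in\mathcal{ONC}_n}\frac{t^{b(P)}}{b(P)!}\,w(P).$$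 The process interpolates between the free and the monotone Poisson process in the following sense. * For $(p,q)=(1,1)$, $\gamma_t$ is the free Poisson process $l_t+l_t^*+l_t^*l_t+m_t$, where $l_tF=\chi_{[0,t]}\otimes F$ is the free creation operator, and its $n$-th vacuum moment is $\sum_{\pi\in\mathcal{NC}_n}t^{b(\pi)}$ for every $n\ge0$. * Let $\mathcal M=\mathbb C\Omega\oplus\bigoplus_{n\ge1}L^2(\{t_1>\dots>t_n\})\subset\mathcal F$ be the monotone Fock space, let $Q$ be the orthogonal projection of $\mathcal F$ onto $\mathcal M$, let $d_t=Q\,l_t\,Q$ be the monotone creation operator, and let $d_t+d_t^*+d_t^*d_t+m_tQ$ be the monotone Poisson process (extended by $0$ to $\mathcal M^\perp$). For $(p,q)=(0,1)$, $\gamma_t$ coincides on $\mathcal M$ with the monotone Poisson process, i.e. $\gamma_tQ=d_t+d_t^*+d_t^*d_t+m_tQ$; both have the same vacuum moments, and the $n$-th moment is $\sum_{P\in\mathcal{MNC}_n}t^{b(P)}/b(P)!$ for every $n\ge0$. -/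

import Mathlib

open MeasureTheory
open scoped ENNReal

noncomputable section

/-! ### The free Fock space over `L²(ℝ₊)` -/

/-- Lebesgue measure on the half-line `ℝ₊ = [0, ∞)`. -/
abbrev rayMeasure : Measure ℝ := volume.restrict (Set.Ici 0)

/-- The one-particle space `H = L²(ℝ₊)`. -/
abbrev OneParticle : Type := Lp ℂ 2 rayMeasure

/-- Lebesgue measure on `ℝ₊ⁿ` (for `n = 0`, the Dirac measure on the one-point space). -/
abbrev rayPow (n : ℕ) : Measure (Fin n → ℝ) := Measure.pi fun _ : Fin n => rayMeasure

/-- The `n`-particle space `H^{⊗ n} ≅ L²(ℝ₊ⁿ)`; for `n = 0` it is `≅ ℂ`. -/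
abbrev NParticle (n : ℕ) : Type := Lp ℂ 2 (rayPow n)

/-- The free Fock space `F(H) = ℂΩ ⊕ ⨁_{n ≥ 1} L²(ℝ₊ⁿ)` (Hilbert space direct sum). -/
abbrev FockSpace : Type := lp NParticle 2

theorem memLp_one_rayPow_zero : MemLp (fun _ => (1 : ℂ)) 2 (rayPow 0) := by
  have : IsFiniteMeasure (rayPow 0) := by
    unfold rayPow
    rw [Measure.pi_of_empty]
    infer_instance
  exact memLp_const 1

/-- The vacuum vector `Ω`. -/
def vacuum : FockSpace := lp.single 2 0 memLp_one_rayPow_zero.toLp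

/-- The vacuum state `φ(X) = ⟨X Ω, Ω⟩`. -/
def vacuumState (X : FockSpace →L[ℂ] FockSpace) : ℂ := inner ℂ vacuum (X vacuum)

/-! ### Two ways to build bounded operators on the Fock space from their components -/

theorem memlp_of_raise (C : ℝ) (hC : 0 ≤ C) (F : FockSpace) (G : ∀ n, NParticle n)
    (h0 : G 0 = 0) (hG : ∀ n, ‖G (n + 1)‖ ≤ C * ‖F n‖) (s : Finset ℕ) :
    ∑ n ∈ s, ‖G n‖ ^ (2 : ℝ≥0∞).toReal ≤ (C * ‖F‖) ^ (2 : ℝ≥0∞).toReal := by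
  have h2 : (0 : ℝ) < (2 : ℝ≥0∞).toReal := by norm_num
  have hsub : s ⊆ Finset.range (s.sup id + 1) := fun n hn =>
    Finset.mem_range.2 (Nat.lt_succ_of_le (Finset.le_sup (f := id) hn))
  calc ∑ n ∈ s, ‖G n‖ ^ (2 : ℝ≥0∞).toReal
      ≤ ∑ n ∈ Finset.range (s.sup id + 1), ‖G n‖ ^ (2 : ℝ≥0∞).toReal :=
        Finset.sum_le_sum_of_subset_of_nonneg hsub fun _ _ _ => by positivity
    _ = ∑ n ∈ Finset.range (s.sup id), ‖G (n + 1)‖ ^ (2 : ℝ≥0∞).toReal := by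
        rw [Finset.sum_range_succ', h0, norm_zero, Real.zero_rpow h2.ne', add_zero]
    _ ≤ ∑ n ∈ Finset.range (s.sup id), C ^ (2 : ℝ≥0∞).toReal * ‖F n‖ ^ (2 : ℝ≥0∞).toReal := by
        refine Finset.sum_le_sum fun n _ => ?_
        rw [← Real.mul_rpow hC (norm_nonneg _)]
        exact Real.rpow_le_rpow (norm_nonneg _) (hG n) h2.le
    _ ≤ (C * ‖F‖) ^ (2 : ℝ≥0∞).toReal := by
        rw [← Finset.mul_sum, Real.mul_rpow hC (norm_nonneg _)]
        gcongr
        exact lp.sum_rpow_le_norm_rpow h2 F _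

theorem memlp_of_diag (C : ℝ) (hC : 0 ≤ C) (F : FockSpace) (G : ∀ n, NParticle n)
    (hG : ∀ n, ‖G n‖ ≤ C * ‖F n‖) (s : Finset ℕ) :
    ∑ n ∈ s, ‖G n‖ ^ (2 : ℝ≥0∞).toReal ≤ (C * ‖F‖) ^ (2 : ℝ≥0∞).toReal := by
  have h2 : (0 : ℝ) < (2 : ℝ≥0∞).toReal := by norm_num
  calc ∑ n ∈ s, ‖G n‖ ^ (2 : ℝ≥0∞).toReal
      ≤ ∑ n ∈ s, C ^ (2 : ℝ≥0∞).toReal * ‖F n‖ ^ (2 : ℝ≥0∞).toReal := by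
        refine Finset.sum_le_sum fun n _ => ?_
        rw [← Real.mul_rpow hC (norm_nonneg _)]
        exact Real.rpow_le_rpow (norm_nonneg _) (hG n) h2.le
    _ ≤ (C * ‖F‖) ^ (2 : ℝ≥0∞).toReal := by
        rw [← Finset.mul_sum, Real.mul_rpow hC (norm_nonneg _)]
        gcongr
        exact lp.sum_rpow_le_norm_rpow h2 F _

/-- The component family `(0, T₀ F₀, T₁ F₁, …)`. -/
def raiseFun (T : ∀ n, NParticle n →ₗ[ℂ] NParticle (n + 1)) (F : ∀ n, NParticle n) :
    ∀ n, NParticle n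
  | 0 => 0
  | n + 1 => T n (F n)

/-- The bounded operator `(F₀, F₁, …) ↦ (0, T₀ F₀, T₁ F₁, …)`, for uniformly bounded `Tₙ`. -/
def fockRaise (T : ∀ n, NParticle n →ₗ[ℂ] NParticle (n + 1))
    (hT : ∃ C : ℝ, 0 ≤ C ∧ ∀ n F, ‖T n F‖ ≤ C * ‖F‖) : FockSpace →L[ℂ] FockSpace :=
  LinearMap.mkContinuousOfExistsBound
    { toFun := fun F => ⟨raiseFun T F, by
        obtain ⟨C, hC, h⟩ := hT
        exact memℓp_gen' (memlp_of_raise C hC F (raiseFun T F) rfl fun n => h n _)⟩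
      map_add' := fun F G => by
        ext1
        funext n
        cases n with
        | zero => exact (add_zero (0 : NParticle 0)).symm
        | succ n => exact map_add (T n) (F n) (G n)
      map_smul' := fun c F => by
        ext1
        funext n
        cases n with
        | zero => exact (smul_zero (A := NParticle 0) c).symm
        | succ n => exact map_smul (T n) c (F n) }
    (by
      obtain ⟨C, hC, h⟩ := hT
      exact ⟨C, fun F => lp.norm_le_of_forall_sum_le (by norm_num)
        (mul_nonneg hC (norm_nonneg _))
        (memlp_of_raise C hC F (raiseFun T F) rfl fun n => h n _)⟩)

/-- The bounded operator `(F₀, F₁, …) ↦ (T₀ F₀, T₁ F₁, …)`, for uniformly bounded `Tₙ`. -/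
def fockDiag (T : ∀ n, NParticle n →ₗ[ℂ] NParticle n)
    (hT : ∃ C : ℝ, 0 ≤ C ∧ ∀ n F, ‖T n F‖ ≤ C * ‖F‖) : FockSpace →L[ℂ] FockSpace :=
  LinearMap.mkContinuousOfExistsBound
    { toFun := fun F => ⟨fun n => T n (F n), by
        obtain ⟨C, hC, h⟩ := hT
        exact memℓp_gen' (memlp_of_diag C hC F (fun n => T n (F n)) fun n => h n _)⟩
      map_add' := fun F G => by
        ext1
        funext n
        exact map_add (T n) (F n) (G n)
      map_smul' := fun c F => by
        ext1
        funext n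
        exact map_smul (T n) c (F n) }
    (by
      obtain ⟨C, hC, h⟩ := hT
      exact ⟨C, fun F => lp.norm_le_of_forall_sum_le (by norm_num)
        (mul_nonneg hC (norm_nonneg _))
        (memlp_of_diag C hC F (fun n => T n (F n)) fun n => h n _)⟩)

/-! ### Multiplication operators -/

/-- A uniformly bounded family of measurable functions `gₙ : ℝⁿ → ℝ`. -/
structure FockMultiplier where
  toFun : ∀ n : ℕ, (Fin n → ℝ) → ℝ
  measurable_toFun : ∀ n, Measurable (toFun n)
  bounded : ∃ C : ℝ, 0 ≤ C ∧ ∀ n x, |toFun n x| ≤ C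

theorem FockMultiplier.memLp (g : FockMultiplier) (n : ℕ) (F : NParticle n) :
    MemLp (fun x => (g.toFun n x : ℂ) * F x) 2 (rayPow n) := by
  obtain ⟨C, -, hC⟩ := g.bounded
  refine (Lp.memLp F).of_le_mul (c := C) ?_ (Filter.Eventually.of_forall fun x => ?_)
  · exact (Complex.measurable_ofReal.comp (g.measurable_toFun n)).aestronglyMeasurable.mul
      (Lp.aestronglyMeasurable F)
  · rw [norm_mul, Complex.norm_real]
    exact mul_le_mul_of_nonneg_right (hC n x) (norm_nonneg _)

/-- Multiplication by `gₙ` on the `n`-particle space. -/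
def FockMultiplier.component (g : FockMultiplier) (n : ℕ) : NParticle n →ₗ[ℂ] NParticle n where
  toFun F := (g.memLp n F).toLp
  map_add' F G := by
    rw [← MemLp.toLp_add]
    refine MemLp.toLp_congr _ _ ?_
    filter_upwards [Lp.coeFn_add F G] with x hx
    simp only [hx, Pi.add_apply, mul_add]
  map_smul' c F := by
    rw [RingHom.id_apply, ← MemLp.toLp_const_smul]
    refine MemLp.toLp_congr _ _ ?_
    filter_upwards [Lp.coeFn_smul c F] with x hx
    simp only [hx, Pi.smul_apply, smul_eq_mul]
    ring

theorem FockMultiplier.exists_bound (g : FockMultiplier) :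
    ∃ C : ℝ, 0 ≤ C ∧ ∀ n F, ‖g.component n F‖ ≤ C * ‖F‖ := by
  obtain ⟨C, hC0, hC⟩ := g.bounded
  refine ⟨C, hC0, fun n F => Lp.norm_le_mul_norm_of_ae_le_mul ?_⟩
  filter_upwards [MemLp.coeFn_toLp (g.memLp n F)] with x hx
  change ‖((g.memLp n F).toLp : NParticle n) x‖ ≤ _
  rw [hx, norm_mul, Complex.norm_real]
  exact mul_le_mul_of_nonneg_right (hC n x) (norm_nonneg _)

/-- The operator `(Fₙ)ₙ ↦ (gₙ Fₙ)ₙ` on the Fock space. -/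
def FockMultiplier.op (g : FockMultiplier) : FockSpace →L[ℂ] FockSpace :=
  fockDiag g.component g.exists_bound

/-! ### Creation operators with a nearest-neighbour coupling -/

/-- A bounded measurable kernel on `ℝ × ℝ`. -/
structure Coupling where
  toFun : ℝ → ℝ → ℝ
  measurable_toFun : Measurable (Function.uncurry toFun)
  bounded : ∃ C : ℝ, ∀ s t, |toFun s t| ≤ C

/-- The factor `k(x₀, x₁)` (equal to `1` if there is only one coordinate). -/
def Coupling.factor (k : Coupling) : ∀ n : ℕ, (Fin (n + 1) → ℝ) → ℝ
  | 0, _ => 1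
  | _ + 1, x => k.toFun (x 0) (x 1)

theorem Coupling.measurable_factor (k : Coupling) (n : ℕ) : Measurable (k.factor n) := by
  cases n with
  | zero => exact measurable_const
  | succ n =>
    have h : Measurable fun x : Fin (n + 1 + 1) → ℝ => (x 0, x 1) :=
      (measurable_pi_apply 0).prodMk (measurable_pi_apply 1)
    exact k.measurable_toFun.comp h

theorem Coupling.factor_bounded (k : Coupling) :
    ∃ C : ℝ, 0 ≤ C ∧ ∀ n x, |k.factor n x| ≤ C := by
  obtain ⟨C, hC⟩ := k.bounded
  refine ⟨max 1 C, le_max_of_le_left zero_le_one, fun n x => ?_⟩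
  cases n with
  | zero => simp [Coupling.factor]
  | succ n => exact (hC _ _).trans (le_max_right _ _)

theorem measurePreserving_split (n : ℕ) :
    MeasurePreserving (fun x : Fin (n + 1) → ℝ => (x 0, Fin.tail x)) (rayPow (n + 1))
      (rayMeasure.prod (rayPow n)) :=
  measurePreserving_piFinSuccAbove (fun _ : Fin (n + 1) => rayMeasure) 0

theorem ae_tail {n : ℕ} {P : (Fin n → ℝ) → Prop} (h : ∀ᵐ y ∂rayPow n, P y) :
    ∀ᵐ x ∂rayPow (n + 1), P (Fin.tail x) :=
  (Measure.quasiMeasurePreserving_snd.comp (measurePreserving_split n).quasiMeasurePreserving).ae h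

theorem memLp_tensor {n : ℕ} (f : OneParticle) (F : NParticle n) :
    MemLp (fun x : Fin (n + 1) → ℝ => f (x 0) * F (Fin.tail x)) 2 (rayPow (n + 1)) ∧
    eLpNorm (fun x : Fin (n + 1) → ℝ => f (x 0) * F (Fin.tail x)) 2 (rayPow (n + 1)) =
      eLpNorm f 2 rayMeasure * eLpNorm F 2 (rayPow n) := by
  have hmeas : AEStronglyMeasurable (fun z : ℝ × (Fin n → ℝ) => f z.1 * F z.2)
      (rayMeasure.prod (rayPow n)) :=
    (Lp.aestronglyMeasurable f).comp_fst.mul (Lp.aestronglyMeasurable F).comp_snd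
  have hnorm : eLpNorm (fun x : Fin (n + 1) → ℝ => f (x 0) * F (Fin.tail x)) 2 (rayPow (n + 1)) =
      eLpNorm f 2 rayMeasure * eLpNorm F 2 (rayPow n) := by
    have h1 := eLpNorm_comp_measurePreserving (p := 2) hmeas (measurePreserving_split n)
    refine h1.trans ?_
    simp only [eLpNorm_eq_lintegral_rpow_enorm_toReal (p := 2) (by norm_num) (by norm_num)]
    rw [← ENNReal.mul_rpow_of_nonneg _ _ (by norm_num)]
    congr 1
    rw [← lintegral_prod_mul ((Lp.aestronglyMeasurable f).enorm.pow_const _)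
      ((Lp.aestronglyMeasurable F).enorm.pow_const _)]
    refine lintegral_congr fun z => ?_
    rw [enorm_mul, ENNReal.mul_rpow_of_nonneg _ _ (by norm_num)]
  refine ⟨⟨hmeas.comp_measurePreserving (measurePreserving_split n), ?_⟩, hnorm⟩
  rw [hnorm]
  exact ENNReal.mul_lt_top (Lp.memLp f).2 (Lp.memLp F).2

theorem Coupling.memLp (k : Coupling) (f : OneParticle) (n : ℕ) (F : NParticle n) :
    MemLp (fun x : Fin (n + 1) → ℝ => (k.factor n x : ℂ) * (f (x 0) * F (Fin.tail x))) 2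
      (rayPow (n + 1)) := by
  obtain ⟨C, -, hC⟩ := k.factor_bounded
  refine (memLp_tensor f F).1.of_le_mul (c := C) ?_ (Filter.Eventually.of_forall fun x => ?_)
  · exact (Complex.measurable_ofReal.comp (k.measurable_factor n)).aestronglyMeasurable.mul
      (memLp_tensor f F).1.1
  · rw [norm_mul, Complex.norm_real]
    exact mul_le_mul_of_nonneg_right (hC n x) (norm_nonneg _)

/-- The map `L²(ℝ₊ⁿ) → L²(ℝ₊ⁿ⁺¹)`,
`F ↦ ((t₁, …, tₙ₊₁) ↦ k(t₁, t₂) f(t₁) F(t₂, …, tₙ₊₁))`, where for `n = 0` there is no factor `k`. -/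
def Coupling.component (k : Coupling) (f : OneParticle) (n : ℕ) :
    NParticle n →ₗ[ℂ] NParticle (n + 1) where
  toFun F := (k.memLp f n F).toLp
  map_add' F G := by
    rw [← MemLp.toLp_add]
    refine MemLp.toLp_congr _ _ ?_
    filter_upwards [ae_tail (Lp.coeFn_add F G)] with x hx
    simp only [hx, Pi.add_apply, mul_add]
  map_smul' c F := by
    rw [RingHom.id_apply, ← MemLp.toLp_const_smul]
    refine MemLp.toLp_congr _ _ ?_
    filter_upwards [ae_tail (Lp.coeFn_smul c F)] with x hx
    simp only [hx, Pi.smul_apply, smul_eq_mul]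
    ring

theorem Coupling.exists_bound (k : Coupling) (f : OneParticle) :
    ∃ C : ℝ, 0 ≤ C ∧ ∀ n F, ‖k.component f n F‖ ≤ C * ‖F‖ := by
  obtain ⟨C, hC0, hC⟩ := k.factor_bounded
  refine ⟨C * ‖f‖, mul_nonneg hC0 (norm_nonneg _), fun n F => ?_⟩
  have h : ‖(memLp_tensor f F).1.toLp‖ = ‖f‖ * ‖F‖ := by
    rw [Lp.norm_toLp, (memLp_tensor f F).2, ENNReal.toReal_mul, Lp.norm_def, Lp.norm_def]
  rw [mul_assoc, ← h]
  refine Lp.norm_le_mul_norm_of_ae_le_mul ?_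
  filter_upwards [MemLp.coeFn_toLp (k.memLp f n F), MemLp.coeFn_toLp (memLp_tensor f F).1]
    with x hx hy
  change ‖((k.memLp f n F).toLp : NParticle (n + 1)) x‖ ≤ _
  rw [hx, hy, norm_mul, Complex.norm_real]
  exact mul_le_mul_of_nonneg_right (hC n x) (norm_nonneg _)

/-- The creation operator with coupling `k`: it maps `Ω` to `f` and `F ∈ L²(ℝ₊ⁿ)`, `n ≥ 1`, to
`(t₁, …, tₙ₊₁) ↦ k(t₁, t₂) f(t₁) F(t₂, …, tₙ₊₁)`. -/
def Coupling.creation (k : Coupling) (f : OneParticle) : FockSpace →L[ℂ] FockSpace :=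
  fockRaise (k.component f) (k.exists_bound f)

/-! ### The `(p, q)`-Poisson process -/

/-- The weight function: `p` if `0 < s < t`, `q` if `0 < t < s`, and `1` otherwise. -/
def pqWeight (p q s t : ℝ) : ℝ :=
  if 0 < s ∧ s < t then p else if 0 < t ∧ t < s then q else 1

theorem measurable_pqWeight (p q : ℝ) : Measurable (Function.uncurry (pqWeight p q)) := by
  unfold pqWeight Function.uncurry
  refine Measurable.ite ?_ measurable_const (Measurable.ite ?_ measurable_const measurable_const)
  · exact (measurableSet_lt measurable_const measurable_fst).inter
      (measurableSet_lt measurable_fst measurable_snd)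
  · exact (measurableSet_lt measurable_const measurable_snd).inter
      (measurableSet_lt measurable_snd measurable_fst)

/-- The coupling `√w(s, t)`. -/
def pqCoupling (p q : ℝ) : Coupling where
  toFun s t := √(pqWeight p q s t)
  measurable_toFun := (measurable_pqWeight p q).sqrt
  bounded := ⟨√p + √q + 1, fun s t => by
    rw [abs_of_nonneg (Real.sqrt_nonneg _)]
    have hp := Real.sqrt_nonneg p
    have hq := Real.sqrt_nonneg q
    unfold pqWeight
    split_ifs
    · linarith
    · linarith
    · rw [Real.sqrt_one]; linarith⟩

/-- The `(p, q)`-creation operator `a(f)`. In terms of the vectors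
`(f₁ ⊛ ⋯ ⊛ fₙ)(t₁, …, tₙ) = f₁(t₁) √w(t₁, t₂) f₂(t₂) ⋯ √w(tₙ₋₁, tₙ) fₙ(tₙ)`
it is given by `a(f) Ω = f` and `a(f) (f₁ ⊛ ⋯ ⊛ fₙ) = f ⊛ f₁ ⊛ ⋯ ⊛ fₙ`. -/
def pqCreation (p q : ℝ) (f : OneParticle) : FockSpace →L[ℂ] FockSpace :=
  (pqCoupling p q).creation f

/-- The characteristic function `χ_{[0,t]}` in `L²(ℝ₊)`. -/
def chi (t : ℝ) : OneParticle :=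
  indicatorConstLp 2 (measurableSet_Icc : MeasurableSet (Set.Icc (0 : ℝ) t))
    ((Measure.restrict_apply_le _ _).trans_lt measure_Icc_lt_top).ne (1 : ℂ)

/-- Multiplication by `χ_{[0,t]}` in the first variable, and by `0` on the vacuum. -/
def gaugeMultiplier (t : ℝ) : FockMultiplier where
  toFun
    | 0, _ => 0
    | _ + 1, x => (Set.Icc (0 : ℝ) t).indicator 1 (x 0)
  measurable_toFun
    | 0 => measurable_const
    | _ + 1 => (measurable_one.indicator measurableSet_Icc).comp (measurable_pi_apply 0)
  bounded := ⟨1, zero_le_one, fun n x => by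
    cases n with
    | zero => simp
    | succ n =>
      simp only [Set.indicator_apply, Pi.one_apply]
      split_ifs <;> simp⟩

/-- The gauge operator `m_t`: `m_t Ω = 0` and `m_t (f₁ ⊛ ⋯ ⊛ fₙ) = (χ_{[0,t]} f₁) ⊛ f₂ ⊛ ⋯ ⊛ fₙ`. -/
def gaugeOp (t : ℝ) : FockSpace →L[ℂ] FockSpace := (gaugeMultiplier t).op

open ContinuousLinearMap in
/-- The `(p, q)`-Poisson process `γ_t = a_t + a_t^* + a_t^* a_t + m_t`. -/
def pqPoisson (p q t : ℝ) : FockSpace →L[ℂ] FockSpace :=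
  pqCreation p q (chi t) + adjoint (pqCreation p q (chi t)) +
    adjoint (pqCreation p q (chi t)) * pqCreation p q (chi t) + gaugeOp t

/-! ### The free and the monotone Poisson process -/

/-- The free creation operator `l(f) F = f ⊗ F`. -/
def freeCreation (f : OneParticle) : FockSpace →L[ℂ] FockSpace :=
  Coupling.creation
    { toFun := fun _ _ => 1
      measurable_toFun := measurable_const
      bounded := ⟨1, fun _ _ => by simp⟩ } f

open ContinuousLinearMap in
/-- The free Poisson process `l_t + l_t^* + l_t^* l_t + m_t`. -/
def freePoisson (t : ℝ) : FockSpace →L[ℂ] FockSpace :=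
  freeCreation (chi t) + adjoint (freeCreation (chi t)) +
    adjoint (freeCreation (chi t)) * freeCreation (chi t) + gaugeOp t

/-- The indicator functions of the simplices `{t₁ > t₂ > ⋯ > tₙ}`. -/
def simplexMultiplier : FockMultiplier where
  toFun n x := {x : Fin n → ℝ | ∀ i j, i < j → x j < x i}.indicator 1 x
  measurable_toFun n := by
    refine measurable_one.indicator ?_
    simp only [Set.ofPred_forall]
    exact MeasurableSet.iInter fun i => MeasurableSet.iInter fun j => MeasurableSet.iInter fun _ =>
      measurableSet_lt (measurable_pi_apply j) (measurable_pi_apply i)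
  bounded := ⟨1, zero_le_one, fun n x => by
    simp only [Set.indicator_apply, Pi.one_apply]
    split_ifs <;> simp⟩

/-- The orthogonal projection of the free Fock space onto the monotone Fock space
`ℂΩ ⊕ ⨁_{n ≥ 1} L²({t₁ > t₂ > ⋯ > tₙ})`. -/
def monotoneProj : FockSpace →L[ℂ] FockSpace := simplexMultiplier.op

/-- The monotone creation operator: the compression of the free creation operator to the monotone
Fock space (extended by `0` to its orthogonal complement). -/
def monotoneCreation (f : OneParticle) : FockSpace →L[ℂ] FockSpace :=
  monotoneProj * freeCreation f * monotoneProj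

open ContinuousLinearMap in
/-- The monotone Poisson process `d_t + d_t^* + d_t^* d_t + m_t` on the monotone Fock space
(extended by `0` to its orthogonal complement), where `d_t` is the monotone creation operator
associated with `χ_{[0,t]}`. -/
def monotonePoisson (t : ℝ) : FockSpace →L[ℂ] FockSpace :=
  monotoneCreation (chi t) + adjoint (monotoneCreation (chi t)) +
    adjoint (monotoneCreation (chi t)) * monotoneCreation (chi t) + gaugeOp t * monotoneProj

end

/-! ### Ordered non-crossing partitions -/

/-- Partitions of `[n]`, modelled on `Fin n`. -/
abbrev PartitionOf (n : ℕ) : Type := Finpartition (Finset.univ : Finset (Fin n))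

/-- There are no `k < m < k' < m'` with `k, k'` in one block and `m, m'` in another. -/
def PartitionOf.IsNonCrossing {n : ℕ} (π : PartitionOf n) : Prop :=
  ∀ A ∈ π.parts, ∀ B ∈ π.parts, A ≠ B →
    ¬ ∃ k ∈ A, ∃ k' ∈ A, ∃ m ∈ B, ∃ m' ∈ B, k < m ∧ m < k' ∧ k' < m'

/-- The block `A` is inner with respect to the block `B`. -/
def IsInner {n : ℕ} (A B : Finset (Fin n)) : Prop :=
  A ≠ B ∧ ∃ a ∈ B, ∃ b ∈ B, ∀ c ∈ A, a < c ∧ c < b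

/-- `A` is inner with respect to `B` and there are no intermediate blocks of `π` between them. -/
def PartitionOf.IsInnerNeighbor {n : ℕ} (π : PartitionOf n) (A B : Finset (Fin n)) : Prop :=
  IsInner A B ∧ ¬ ∃ C ∈ π.parts, IsInner A C ∧ IsInner C B

/-- Ordered partitions of `[n]`: a partition together with an enumeration
`(P_0, …, P_{b-1})` of its blocks. -/
abbrev OrderedPartition (n : ℕ) : Type :=
  (π : PartitionOf n) × (Fin π.parts.card ≃ {A : Finset (Fin n) // A ∈ π.parts})

namespace OrderedPartition

/-- The number of blocks `b(P)`. -/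
def numBlocks {n : ℕ} (P : OrderedPartition n) : ℕ := P.1.parts.card

/-- The `i`-th block. -/
def block {n : ℕ} (P : OrderedPartition n) (i : Fin P.1.parts.card) : Finset (Fin n) := P.2 i

open Classical in
/-- The number `e(P)` of disorders: pairs `i < j` such that `P_i` is inner with respect to `P_j`
and the two blocks are neighboring. -/
noncomputable def disorders {n : ℕ} (P : OrderedPartition n) : ℕ :=
  (Finset.univ.filter fun ij : Fin P.1.parts.card × Fin P.1.parts.card =>
    ij.1 < ij.2 ∧ P.1.IsInnerNeighbor (P.block ij.1) (P.block ij.2)).card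

open Classical in
/-- The number `e'(P)` of orders: pairs `i < j` such that `P_j` is inner with respect to `P_i`
and the two blocks are neighboring. -/
noncomputable def orders {n : ℕ} (P : OrderedPartition n) : ℕ :=
  (Finset.univ.filter fun ij : Fin P.1.parts.card × Fin P.1.parts.card =>
    ij.1 < ij.2 ∧ P.1.IsInnerNeighbor (P.block ij.2) (P.block ij.1)).card

/-- The weight `w(P) = p^{e(P)} q^{e'(P)}` (with `0 ^ 0 = 1`). -/
noncomputable def weight {n : ℕ} (p q : ℝ) (P : OrderedPartition n) : ℝ :=
  p ^ P.disorders * q ^ P.orders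

/-- If the block `P_j` is inner with respect to the block `P_i`, then `i < j`. -/
def IsMonotone {n : ℕ} (P : OrderedPartition n) : Prop :=
  ∀ i j, IsInner (P.block j) (P.block i) → i < j

end OrderedPartition

open Classical in
/-- The non-crossing partitions of `[n]`. -/
noncomputable def NC (n : ℕ) : Finset (PartitionOf n) :=
  Finset.univ.filter fun π => π.IsNonCrossing

open Classical in
/-- The ordered non-crossing partitions of `[n]`. -/
noncomputable def ONC (n : ℕ) : Finset (OrderedPartition n) :=
  Finset.univ.filter fun P => P.1.IsNonCrossing

open Classical in
/-- The monotone non-crossing partitions of `[n]`. -/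
noncomputable def MNC (n : ℕ) : Finset (OrderedPartition n) :=
  Finset.univ.filter fun P => P.1.IsNonCrossing ∧ P.IsMonotone

/-!
The process factors as `γ_t = (1 + a_t^*) (a_t + m_t)`, because `a_t^* m_t = (m_t a_t)^* = a_t^*`.
Expanding `γ_t ^ n Ω` gives a sum over words in four letters; a letter tells whether a block is
opened (`a_t` rather than `m_t`) and whether a block is closed (`a_t^*` rather than `1`) at a
position. Such a word drives a stack of open blocks, and the words that never read from an empty
stack and end with an empty one are exactly the words of the non-crossing partitions
(`PartitionOf.sum_NC_eq_sum_word`); all other words contribute `0` to the vacuum moment.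

On the Fock space, each intermediate vector is a multiple of `f₁ ⊛ ⋯ ⊛ fₘ = a(f₁) ⋯ a(fₘ) Ω`, with
one factor for each open block. The identity `a_t^* a(f) F = (∫₀ᵗ w(s, t₁) f(s) ds) · F`
(`pqCreation_adjoint_mul`) shows that closing a block integrates its variable `s` against
`w(s, t₁)`, where `t₁` is the variable of the next block on the stack, which is the block it is an
inner neighbor of. Attaching a variable to each block, the word of `π` thus contributes
`∫_{[0,t]^π} ∏ w(s_A, s_B)`, the product being over the pairs of blocks such that `A` is an inner
neighbor of `B` (`exists_wordVec_eq`, `PartitionOf.IsNonCrossing.wordWeight_word`).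

The integrand depends on the relative order of the variables only, and each of the `b!` orders
occurs on a set of measure `t ^ b / b!` (`lintegral_prod_pqWeight`). An order of the variables is an
enumeration of the blocks, and the value of the integrand is then the weight of the ordered
partition (`OrderedPartition.weight_eq_prod`).

For `(p, q) = (1, 1)` all couplings are `1`. For `(p, q) = (0, 1)` the weight is `1` on the monotone
partitions and `0` on the others, and with `Q` the projection onto the monotone Fock space one has
`Q a_t = a_t Q = d_t`, whence `γ_t Q` is the monotone Poisson process, which maps into the range of
`Q`.
-/

/-! ### Operators on the Fock space -/

/-- A nonnegative bounded measurable function on the line. -/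
structure BoundedFn where
  toFun : ℝ → ℝ
  measurable_toFun : Measurable toFun
  nonneg : ∀ x, 0 ≤ toFun x
  bounded : ∃ C : ℝ, ∀ x, toFun x ≤ C

namespace BoundedFn

instance : CoeFun BoundedFn fun _ => ℝ → ℝ := ⟨toFun⟩

/-- The constant function `1`. -/
def one : BoundedFn := ⟨fun _ => 1, measurable_const, fun _ => zero_le_one, 1, fun _ => le_rfl⟩

/-- The pointwise product. -/
def mul (f g : BoundedFn) : BoundedFn where
  toFun x := f x * g x
  measurable_toFun := f.measurable_toFun.mul g.measurable_toFun
  nonneg x := mul_nonneg (f.nonneg x) (g.nonneg x)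
  bounded := by
    obtain ⟨C, hC⟩ := f.bounded
    obtain ⟨D, hD⟩ := g.bounded
    exact ⟨C * D, fun x => mul_le_mul (hC x) (hD x) (g.nonneg x) ((f.nonneg x).trans (hC x))⟩

/-- The restriction of `f` to `[0, t]`, as a vector of the one-particle space. -/
noncomputable def vec (t : ℝ) (f : BoundedFn) : OneParticle :=
  MemLp.toLp (fun x => (Set.Icc (0 : ℝ) t).indicator (fun x => (f x : ℂ)) x) (by
    obtain ⟨C, hC⟩ := f.bounded
    refine (memLp_indicator_const 2 (measurableSet_Icc (a := (0 : ℝ)) (b := t)) (C : ℂ)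
      (Or.inr ((Measure.restrict_apply_le _ _).trans_lt measure_Icc_lt_top).ne)).mono ?_ ?_
    · exact ((Complex.measurable_ofReal.comp f.measurable_toFun).indicator
        measurableSet_Icc).aestronglyMeasurable
    · refine Filter.Eventually.of_forall fun x => ?_
      simp only [Set.indicator_apply]
      split_ifs
      · rw [Complex.norm_real, Complex.norm_real, Real.norm_of_nonneg (f.nonneg x),
          Real.norm_of_nonneg ((f.nonneg x).trans (hC x))]
        exact hC x
      · simp)

theorem coeFn_vec (t : ℝ) (f : BoundedFn) : (f.vec t : ℝ → ℂ) =ᵐ[rayMeasure]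
    fun x => (Set.Icc (0 : ℝ) t).indicator (fun x => (f x : ℂ)) x :=
  MemLp.coeFn_toLp _

theorem vec_one (t : ℝ) : one.vec t = chi t := by
  have h : (chi t : ℝ → ℂ) =ᵐ[rayMeasure] (Set.Icc (0 : ℝ) t).indicator fun _ => (1 : ℂ) :=
    indicatorConstLp_coeFn
  refine Lp.ext ?_
  filter_upwards [coeFn_vec t one, h] with x h1 h2
  rw [h1, h2]
  simp [one]

end BoundedFn

theorem pqWeight_nonneg {p q : ℝ} (hp : 0 ≤ p) (hq : 0 ≤ q) (s t : ℝ) : 0 ≤ pqWeight p q s t := by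
  unfold pqWeight
  split_ifs
  · exact hp
  · exact hq
  · exact zero_le_one

theorem pqWeight_le {p q : ℝ} (hp : 0 ≤ p) (hq : 0 ≤ q) (s t : ℝ) :
    pqWeight p q s t ≤ p + q + 1 := by
  unfold pqWeight
  split_ifs <;> linarith

theorem BoundedFn.integrableOn (t : ℝ) (f : BoundedFn) :
    Integrable f (volume.restrict (Set.Icc (0 : ℝ) t)) := by
  obtain ⟨C, hC⟩ := f.bounded
  refine (integrable_const C).mono' f.measurable_toFun.aestronglyMeasurable
    (Filter.Eventually.of_forall fun x => ?_)
  rw [Real.norm_of_nonneg (f.nonneg x)]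
  exact hC x

theorem integrable_pqWeight_mul {p q : ℝ} (hp : 0 ≤ p) (hq : 0 ≤ q) (t : ℝ) (f : BoundedFn)
    (y : ℝ) :
    Integrable (fun s => pqWeight p q s y * f s) (volume.restrict (Set.Icc (0 : ℝ) t)) := by
  refine ((f.integrableOn t).const_mul (p + q + 1)).mono' ?_ ?_
  · have h : Measurable fun s => pqWeight p q s y :=
      (measurable_pqWeight p q).comp (measurable_id.prodMk measurable_const)
    exact (h.mul f.measurable_toFun).aestronglyMeasurable
  · refine Filter.Eventually.of_forall fun x => ?_
    rw [Real.norm_of_nonneg (mul_nonneg (pqWeight_nonneg hp hq _ _) (f.nonneg x))]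
    exact mul_le_mul_of_nonneg_right (pqWeight_le hp hq _ _) (f.nonneg x)

/-- The function `y ↦ ∫₀ᵗ w(s, y) f(s) ds`: the effect on the enclosing variable `y` of integrating
out the variable `s`. -/
noncomputable def BoundedFn.smear {p q : ℝ} (hp : 0 ≤ p) (hq : 0 ≤ q) (t : ℝ) (f : BoundedFn) :
    BoundedFn where
  toFun y := ∫ s in Set.Icc (0 : ℝ) t, pqWeight p q s y * f s
  measurable_toFun := by
    refine StronglyMeasurable.measurable (StronglyMeasurable.integral_prod_left ?_)
    exact ((measurable_pqWeight p q).mul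
      (f.measurable_toFun.comp measurable_fst)).stronglyMeasurable
  nonneg y := integral_nonneg fun s => mul_nonneg (pqWeight_nonneg hp hq _ _) (f.nonneg s)
  bounded := ⟨∫ s in Set.Icc (0 : ℝ) t, (p + q + 1) * f s, fun y =>
    integral_mono (integrable_pqWeight_mul hp hq t f y) ((f.integrableOn t).const_mul _)
      fun s => mul_le_mul_of_nonneg_right (pqWeight_le hp hq _ _) (f.nonneg s)⟩

/-- Multiplication by `h` in the first variable, and by the scalar `c` on the vacuum. -/
def firstMultiplier (h : BoundedFn) (c : ℝ) : FockMultiplier where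
  toFun
    | 0, _ => c
    | _ + 1, x => h (x 0)
  measurable_toFun
    | 0 => measurable_const
    | _ + 1 => h.measurable_toFun.comp (measurable_pi_apply 0)
  bounded := by
    obtain ⟨C, hC⟩ := h.bounded
    refine ⟨max |c| C, le_max_of_le_left (abs_nonneg c), fun n x => ?_⟩
    cases n with
    | zero => exact le_max_left _ _
    | succ n => exact (abs_of_nonneg (h.nonneg _)).trans_le ((hC _).trans (le_max_right _ _))

theorem FockMultiplier.op_apply (g : FockMultiplier) (F : FockSpace) (n : ℕ) :
    g.op F n = g.component n (F n) := rfl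

theorem Coupling.creation_apply_zero (k : Coupling) (f : OneParticle) (F : FockSpace) :
    k.creation f F 0 = 0 := rfl

theorem Coupling.creation_apply_succ (k : Coupling) (f : OneParticle) (F : FockSpace) (n : ℕ) :
    k.creation f F (n + 1) = k.component f n (F n) := rfl

theorem FockMultiplier.coeFn_component (g : FockMultiplier) (n : ℕ) (F : NParticle n) :
    (g.component n F : (Fin n → ℝ) → ℂ) =ᵐ[rayPow n] fun x => (g.toFun n x : ℂ) * F x :=
  MemLp.coeFn_toLp (g.memLp n F)

theorem Coupling.coeFn_component (k : Coupling) (f : OneParticle) (n : ℕ) (F : NParticle n) :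
    (k.component f n F : (Fin (n + 1) → ℝ) → ℂ) =ᵐ[rayPow (n + 1)]
      fun x => (k.factor n x : ℂ) * (f (x 0) * F (Fin.tail x)) :=
  MemLp.coeFn_toLp (k.memLp f n F)

theorem ae_head {n : ℕ} {P : ℝ → Prop} (h : ∀ᵐ y ∂rayMeasure, P y) :
    ∀ᵐ x ∂rayPow (n + 1), P (x 0) :=
  (Measure.quasiMeasurePreserving_fst.comp (measurePreserving_split n).quasiMeasurePreserving).ae h

theorem FockMultiplier.op_vacuum (g : FockMultiplier) (c : ℝ) (hc : ∀ x, g.toFun 0 x = c) :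
    g.op vacuum = (c : ℂ) • vacuum := by
  ext1
  funext n
  rw [g.op_apply]
  cases n with
  | zero =>
    refine Lp.ext ?_
    filter_upwards [g.coeFn_component 0 (vacuum 0), Lp.coeFn_smul (c : ℂ) (vacuum 0)] with x h1 h2
    rw [h1, hc, lp.coeFn_smul, Pi.smul_apply, h2, Pi.smul_apply, smul_eq_mul]
  | succ n =>
    have h0 : vacuum (n + 1) = 0 := lp.single_apply_ne 2 0 _ (Nat.succ_ne_zero n)
    rw [lp.coeFn_smul, Pi.smul_apply, h0, map_zero, smul_zero]

theorem norm_vacuum : ‖vacuum‖ = 1 := by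
  have h : rayPow 0 = Measure.dirac isEmptyElim := Measure.pi_of_empty _ _
  unfold vacuum
  rw [lp.norm_single (by norm_num), Lp.norm_toLp, h, eLpNorm_const _ (by norm_num)]
  · simp
  · exact NeZero.ne _

theorem inner_vacuum_self : inner ℂ vacuum vacuum = 1 := by
  rw [inner_self_eq_norm_sq_to_K, norm_vacuum]; simp

theorem inner_vacuum_creation (k : Coupling) (f : OneParticle) (F : FockSpace) :
    inner ℂ vacuum (k.creation f F) = 0 := by
  unfold vacuum
  rw [lp.inner_single_left, k.creation_apply_zero, inner_zero_right]

/-- A multiplication in the first variable is absorbed by the function that was created last. -/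
theorem firstMultiplier_op_creation (k : Coupling) (t : ℝ) (h f : BoundedFn) (c : ℝ)
    (F : FockSpace) :
    (firstMultiplier h c).op (k.creation (f.vec t) F) = k.creation ((h.mul f).vec t) F := by
  ext1
  funext n
  rw [FockMultiplier.op_apply]
  cases n with
  | zero => rw [k.creation_apply_zero, k.creation_apply_zero, map_zero]
  | succ n =>
    rw [k.creation_apply_succ, k.creation_apply_succ]
    refine Lp.ext ?_
    filter_upwards [(firstMultiplier h c).coeFn_component (n + 1) (k.component (f.vec t) n (F n)),
      k.coeFn_component (f.vec t) n (F n), k.coeFn_component ((h.mul f).vec t) n (F n),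
      ae_head (f.coeFn_vec t), ae_head ((h.mul f).coeFn_vec t)] with x h1 h2 h3 h4 h5
    rw [h1, h2, h3, h4, h5]
    simp only [Set.indicator_apply, BoundedFn.mul, firstMultiplier]
    split_ifs
    · push_cast; ring
    · simp

/-- The operator `m_t` fixes all vectors whose first variable is restricted to `[0, t]`. -/
theorem gaugeOp_creation (k : Coupling) (t : ℝ) (f : BoundedFn) (F : FockSpace) :
    gaugeOp t (k.creation (f.vec t) F) = k.creation (f.vec t) F := by
  ext1
  funext n
  unfold gaugeOp
  rw [FockMultiplier.op_apply]
  cases n with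
  | zero => rw [k.creation_apply_zero, map_zero]
  | succ n =>
    rw [k.creation_apply_succ]
    refine Lp.ext ?_
    filter_upwards [(gaugeMultiplier t).coeFn_component (n + 1) (k.component (f.vec t) n (F n)),
      k.coeFn_component (f.vec t) n (F n), ae_head (f.coeFn_vec t)] with x h1 h2 h4
    rw [h1, h2, h4]
    simp only [Set.indicator_apply, gaugeMultiplier]
    split_ifs <;> simp

theorem gaugeOp_vacuum (t : ℝ) : gaugeOp t vacuum = 0 := by
  unfold gaugeOp
  rw [FockMultiplier.op_vacuum _ 0 fun x => rfl]
  simp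

theorem pqCoupling_factor_sq {p q : ℝ} (hp : 0 ≤ p) (hq : 0 ≤ q) (n : ℕ) (x : Fin (n + 1 + 1) → ℝ) :
    ((pqCoupling p q).factor (n + 1) x) ^ 2 = pqWeight p q (x 0) (x 1) :=
  Real.sq_sqrt (pqWeight_nonneg hp hq _ _)

/-- The operator `a(g)^* a(f)` on the `n`-particle space, in its weak form: the squared coupling is
integrated over the variable which `a(f)` creates and `a(g)^*` annihilates. -/
theorem Coupling.inner_component (k : Coupling) (t : ℝ) (f g : BoundedFn) (n : ℕ)
    (F G : NParticle n) (m : (Fin n → ℝ) → ℝ)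
    (hm : ∀ y, m y = ∫ s in Set.Icc (0 : ℝ) t, k.factor n (Fin.cons s y) ^ 2 * (f s * g s)) :
    inner ℂ (k.component (f.vec t) n F) (k.component (g.vec t) n G) =
      ∫ y, (m y : ℂ) * inner ℂ (F y) (G y) ∂rayPow n := by
  set Φ : ℝ × (Fin n → ℝ) → ℂ := fun z =>
    (((Set.Icc (0 : ℝ) t).indicator
      (fun s => k.factor n (Fin.cons s z.2) ^ 2 * (f s * g s)) z.1 : ℝ) : ℂ) *
        inner ℂ (F z.2) (G z.2) with hΦ
  have key : (fun x => inner ℂ (k.component (f.vec t) n F x) (k.component (g.vec t) n G x))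
      =ᵐ[rayPow (n + 1)] fun x => Φ (x 0, Fin.tail x) := by
    filter_upwards [k.coeFn_component (f.vec t) n F, k.coeFn_component (g.vec t) n G,
      ae_head (f.coeFn_vec t), ae_head (g.coeFn_vec t)] with x h1 h2 h3 h4
    rw [h1, h2, h3, h4]
    simp only [hΦ, Set.indicator_apply, RCLike.inner_apply]
    have hx : (Fin.cons (x 0) (Fin.tail x) : Fin (n + 1) → ℝ) = x := Fin.cons_self_tail x
    split_ifs
    · simp only [map_mul, Complex.conj_ofReal, Complex.ofReal_mul, Complex.ofReal_pow, hx]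
      ring
    · simp
  have hint : Integrable (fun x => Φ (x 0, Fin.tail x)) (rayPow (n + 1)) :=
    (L2.integrable_inner (𝕜 := ℂ) _ _).congr key
  have hmp := measurePreserving_piFinSuccAbove (fun _ : Fin (n + 1) => rayMeasure) 0
  have hint2 : Integrable Φ (rayMeasure.prod (rayPow n)) :=
    (hmp.integrable_comp_emb (MeasurableEquiv.measurableEmbedding _)).1 hint
  rw [L2.inner_def, integral_congr_ae key]
  have h2 : ∫ x, Φ (x 0, Fin.tail x) ∂rayPow (n + 1) = ∫ z, Φ z ∂(rayMeasure.prod (rayPow n)) :=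
    hmp.integral_comp' Φ
  rw [h2, integral_prod_symm _ hint2]
  refine integral_congr_ae (Filter.Eventually.of_forall fun y => ?_)
  simp only [hΦ]
  rw [integral_mul_const, integral_complex_ofReal, integral_indicator measurableSet_Icc,
    Measure.restrict_restrict measurableSet_Icc,
    Set.inter_eq_left.2 Set.Icc_subset_Ici_self, hm]

theorem adjoint_mul_creation (k : Coupling) (t : ℝ) (f g : BoundedFn) (M : FockMultiplier)
    (hM : ∀ n y, M.toFun n y =
      ∫ s in Set.Icc (0 : ℝ) t, k.factor n (Fin.cons s y) ^ 2 * (f s * g s)) (F : FockSpace) :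
    ContinuousLinearMap.adjoint (k.creation (g.vec t)) (k.creation (f.vec t) F) = M.op F := by
  refine ext_inner_right ℂ fun G => ?_
  have hs := (lp.summable_inner (𝕜 := ℂ) (k.creation (f.vec t) F)
    (k.creation (g.vec t) G)).tsum_eq_zero_add
  rw [k.creation_apply_zero, inner_zero_left, zero_add] at hs
  rw [ContinuousLinearMap.adjoint_inner_left, lp.inner_eq_tsum, lp.inner_eq_tsum, hs]
  refine tsum_congr fun n => ?_
  rw [k.creation_apply_succ, k.creation_apply_succ, k.inner_component t f g n _ _ _ (hM n),
    M.op_apply, L2.inner_def]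
  refine integral_congr_ae ?_
  filter_upwards [M.coeFn_component n (F n)] with x hx
  rw [hx]
  simp only [RCLike.inner_apply, map_mul, Complex.conj_ofReal]
  ring

/-- `a_t^* a(f)` is the multiplication by `∫₀ᵗ w(s, t₁) f(s) ds`, and by `∫₀ᵗ f(s) ds` on the
vacuum. -/
theorem pqCreation_adjoint_mul {p q : ℝ} (hp : 0 ≤ p) (hq : 0 ≤ q) (t : ℝ) (f : BoundedFn)
    (F : FockSpace) :
    ContinuousLinearMap.adjoint (pqCreation p q (chi t)) (pqCreation p q (f.vec t) F) =
      (firstMultiplier (f.smear hp hq t) (∫ s in Set.Icc (0 : ℝ) t, f s)).op F := by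
  rw [← BoundedFn.vec_one]
  refine adjoint_mul_creation (pqCoupling p q) t f BoundedFn.one _ (fun n y => ?_) F
  cases n with
  | zero => simp [firstMultiplier, Coupling.factor, BoundedFn.one]
  | succ n =>
    simp only [pqCoupling_factor_sq hp hq]
    simp [firstMultiplier, BoundedFn.one, BoundedFn.smear]

/-! ### Words, stacks and non-crossing partitions -/

/-- The stack of open blocks before position `k` is read, with the most recently opened block on
top. A word assigns to each position two flags: whether a block is opened there, and whether the
block on top of the stack is closed there. A block is represented by the position opening it. -/
def stack (u : ℕ → Bool × Bool) : ℕ → List ℕ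
  | 0 => []
  | k + 1 =>
    if (u k).2 then (if (u k).1 then k :: stack u k else stack u k).tail
    else if (u k).1 then k :: stack u k else stack u k

/-- The stack at position `k` after a possible opening and before a possible closing. Its top is the
block to which `k` belongs. -/
def active (u : ℕ → Bool × Bool) (k : ℕ) : List ℕ :=
  if (u k).1 then k :: stack u k else stack u k

/-- The position opening the block to which `k` belongs. -/
def label (u : ℕ → Bool × Bool) (k : ℕ) : ℕ := (active u k).headD 0

/-- The word of length `n` never reads from an empty stack, and closes all its blocks. -/
def Admissible (u : ℕ → Bool × Bool) (n : ℕ) : Prop :=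
  (∀ k < n, active u k ≠ []) ∧ stack u n = []

theorem stack_succ (u : ℕ → Bool × Bool) (k : ℕ) :
    stack u (k + 1) = if (u k).2 then (active u k).tail else active u k := rfl

theorem stack_succ_subset (u : ℕ → Bool × Bool) (k : ℕ) : stack u (k + 1) ⊆ active u k := by
  rw [stack_succ]
  split_ifs
  · exact List.tail_subset _
  · exact List.Subset.refl _

theorem stack_spec (u : ℕ → Bool × Bool) (k : ℕ) :
    (stack u k).Pairwise (· > ·) ∧ ∀ i ∈ stack u k, i < k ∧ (u i).1 = true := by
  induction k with
  | zero => simp [stack]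
  | succ k ih =>
    have ha : (active u k).Pairwise (· > ·) ∧ ∀ i ∈ active u k, i < k + 1 ∧ (u i).1 = true := by
      unfold active
      split_ifs with h
      · refine ⟨List.pairwise_cons.2 ⟨fun i hi => (ih.2 i hi).1, ih.1⟩, fun i hi => ?_⟩
        rcases List.mem_cons.1 hi with rfl | hi
        · exact ⟨Nat.lt_succ_self _, h⟩
        · exact ⟨(ih.2 i hi).1.trans (Nat.lt_succ_self _), (ih.2 i hi).2⟩
      · exact ⟨ih.1, fun i hi => ⟨(ih.2 i hi).1.trans (Nat.lt_succ_self _), (ih.2 i hi).2⟩⟩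
    refine ⟨?_, fun i hi => ha.2 i (stack_succ_subset u k hi)⟩
    rw [stack_succ]
    split_ifs
    · exact ha.1.tail
    · exact ha.1

theorem active_pairwise (u : ℕ → Bool × Bool) (k : ℕ) : (active u k).Pairwise (· > ·) := by
  unfold active
  split_ifs with h
  · exact List.pairwise_cons.2 ⟨fun i hi => ((stack_spec u k).2 i hi).1, (stack_spec u k).1⟩
  · exact (stack_spec u k).1

theorem mem_active_iff (u : ℕ → Bool × Bool) (i k : ℕ) :
    i ∈ active u k ↔ i ∈ stack u k ∨ (i = k ∧ (u k).1 = true) := by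
  unfold active
  split_ifs with h
  · simp [h, or_comm]
  · simp [h]

theorem active_spec (u : ℕ → Bool × Bool) (k i : ℕ) (hi : i ∈ active u k) :
    i ≤ k ∧ (u i).1 = true := by
  rcases (mem_active_iff u i k).1 hi with h | ⟨rfl, h⟩
  · exact ⟨((stack_spec u k).2 i h).1.le, ((stack_spec u k).2 i h).2⟩
  · exact ⟨le_rfl, h⟩

theorem active_eq_cons {u : ℕ → Bool × Bool} {k : ℕ} (h : active u k ≠ []) :
    active u k = label u k :: (active u k).tail := by
  unfold label
  cases hL : active u k with
  | nil => exact absurd hL h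
  | cons a l => rfl

theorem label_mem {u : ℕ → Bool × Bool} {k : ℕ} (h : active u k ≠ []) :
    label u k ∈ active u k := by
  rw [active_eq_cons h]; exact List.mem_cons_self

theorem label_le {u : ℕ → Bool × Bool} {k : ℕ} (h : active u k ≠ []) : label u k ≤ k :=
  (active_spec u k _ (label_mem h)).1

theorem le_label {u : ℕ → Bool × Bool} {k i : ℕ} (hi : i ∈ active u k) : i ≤ label u k := by
  have h : active u k ≠ [] := List.ne_nil_of_mem hi
  have hp := active_pairwise u k
  rw [active_eq_cons h] at hi hp
  rcases List.mem_cons.1 hi with rfl | hi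
  · exact le_rfl
  · exact le_of_lt (List.rel_of_pairwise_cons hp hi)

theorem mem_active_tail_iff {u : ℕ → Bool × Bool} {k i : ℕ} :
    i ∈ (active u k).tail ↔ i ∈ active u k ∧ i ≠ label u k := by
  rcases eq_or_ne (active u k) [] with h | h
  · simp [h]
  · have hp := active_pairwise u k
    rw [active_eq_cons h] at hp
    conv_rhs => rw [active_eq_cons h]
    constructor
    · exact fun hi => ⟨List.mem_cons_of_mem _ hi, (List.rel_of_pairwise_cons hp hi).ne⟩
    · exact fun hi => (List.mem_cons.1 hi.1).resolve_left hi.2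

theorem mem_stack_succ_iff {u : ℕ → Bool × Bool} {k i : ℕ} :
    i ∈ stack u (k + 1) ↔ i ∈ active u k ∧ ((u k).2 = true → i ≠ label u k) := by
  rw [stack_succ]
  split_ifs with h
  · simp [h, mem_active_tail_iff]
  · simp [h]

theorem label_eq_self {u : ℕ → Bool × Bool} {k : ℕ} (h : (u k).1 = true) : label u k = k := by
  unfold label active
  simp [h]

/-- A block that has been closed is never reopened. -/
theorem mem_active_of_le {u : ℕ → Bool × Bool} {i b c : ℕ} (hib : i ≤ b) (hbc : b ≤ c)
    (hi : i ∈ active u c) : i ∈ active u b := by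
  induction c, hbc using Nat.le_induction with
  | base => exact hi
  | succ c hbc ih =>
    rcases (mem_active_iff u i (c + 1)).1 hi with h | ⟨h, -⟩
    · exact ih (stack_succ_subset u c h)
    · omega

/-- Two blocks cannot cross: each would be below the other on the stack. -/
theorem label_eq_of_crossing {u : ℕ → Bool × Bool} {a b c d : ℕ} (ha : active u a ≠ [])
    (hb : active u b ≠ []) (hc : active u c ≠ []) (hd : active u d ≠ [])
    (hab : a < b) (hbc : b < c) (hcd : c < d) (hac : label u a = label u c)
    (hbd : label u b = label u d) : label u a = label u b := by
  have h1 : label u a ∈ active u b :=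
    mem_active_of_le ((label_le ha).trans hab.le) hbc.le (hac ▸ label_mem hc)
  have h2 : label u b ∈ active u c :=
    mem_active_of_le ((label_le hb).trans hbc.le) hcd.le (hbd ▸ label_mem hd)
  exact le_antisymm (le_label h1) (hac ▸ le_label h2)

/-- A block is opened at `j` exactly if `j` is the first position with its label. -/
theorem first_iff {u : ℕ → Bool × Bool} {n : ℕ} (hu : ∀ k < n, active u k ≠ []) {j : ℕ}
    (hj : j < n) : (u j).1 = true ↔ ∀ i < n, label u i = label u j → j ≤ i := by
  constructor
  · intro h i hi hij
    rw [label_eq_self h] at hij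
    exact hij ▸ label_le (hu i hi)
  · intro h
    have hl := active_spec u j _ (label_mem (hu j hj))
    have := h (label u j) (hl.1.trans_lt hj) (label_eq_self hl.2)
    have heq : label u j = j := le_antisymm hl.1 this
    rw [heq] at hl
    exact hl.2

/-- A block is closed at `j` exactly if `j` is the last position with its label. -/
theorem last_iff {u : ℕ → Bool × Bool} {n : ℕ} (hu : Admissible u n) {j : ℕ}
    (hj : j < n) : (u j).2 = true ↔ ∀ i < n, label u i = label u j → i ≤ j := by
  constructor
  · intro h i hi hij
    by_contra! hlt
    have h1 : label u j ∈ active u (j + 1) := mem_active_of_le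
      ((label_le (hu.1 j hj)).trans (Nat.le_succ j)) hlt (hij ▸ label_mem (hu.1 i hi))
    rcases (mem_active_iff u _ _).1 h1 with h2 | ⟨h2, -⟩
    · exact (mem_stack_succ_iff.1 h2).2 h rfl
    · have := label_le (hu.1 j hj)
      omega
  · intro h
    by_contra hlast
    have key : ∀ m, j + 1 ≤ m → m ≤ n → label u j ∈ stack u m := by
      intro m hm
      induction m, hm using Nat.le_induction with
      | base =>
        exact fun _ => mem_stack_succ_iff.2 ⟨label_mem (hu.1 j hj), fun h' => absurd h' hlast⟩
      | succ m hm ih =>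
        refine fun hmn => mem_stack_succ_iff.2
          ⟨(mem_active_iff u _ _).2 (Or.inl (ih (by omega))), fun _ heq => ?_⟩
        have := h m (by omega) heq.symm
        omega
    have := key n hj le_rfl
    rw [hu.2] at this
    exact List.not_mem_nil this

/-- The extension of a word of length `n` to all positions; the letters at positions `≥ n` are
irrelevant. -/
def extendWord {n : ℕ} (u : Fin n → Bool × Bool) (k : ℕ) : Bool × Bool :=
  if h : k < n then u ⟨k, h⟩ else (true, true)

theorem extendWord_coe {n : ℕ} (u : Fin n → Bool × Bool) (i : Fin n) : extendWord u i = u i := by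
  simp [extendWord]

namespace PartitionOf

variable {n : ℕ}

/-- The word of a partition: which positions are the first, and which the last of their block. -/
def word (π : PartitionOf n) (i : Fin n) : Bool × Bool :=
  (decide (∀ j ∈ π.part i, i ≤ j), decide (∀ j ∈ π.part i, j ≤ i))

open Classical in
/-- The partition whose blocks are the sets of positions with the same label. -/
noncomputable def ofWord (u : Fin n → Bool × Bool) : PartitionOf n :=
  Finpartition.ofSetoid (Setoid.ker fun i : Fin n => label (extendWord u) i)

theorem mem_part_self (π : PartitionOf n) (i : Fin n) : i ∈ π.part i :=
  (Finpartition.mem_part_self π).2 (Finset.mem_univ i)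

theorem part_mem (π : PartitionOf n) (i : Fin n) : π.part i ∈ π.parts :=
  (Finpartition.part_mem π).2 (Finset.mem_univ i)

theorem mem_part_iff (π : PartitionOf n) {i j : Fin n} : i ∈ π.part j ↔ π.part i = π.part j :=
  Finpartition.mem_part_iff_part_eq_part π (Finset.mem_univ i) (Finset.mem_univ j)

theorem mem_part_ofWord (u : Fin n → Bool × Bool) {i j : Fin n} :
    i ∈ (ofWord u).part j ↔ label (extendWord u) i = label (extendWord u) j := by
  classical
  exact Finpartition.mem_part_ofSetoid_iff_rel.trans eq_comm

theorem ofWord_isNonCrossing {u : Fin n → Bool × Bool} (hu : Admissible (extendWord u) n) :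
    (ofWord u).IsNonCrossing := by
  rintro A hA B hB hAB ⟨a, ha, c, hc, b, hb, d, hd, hab, hbc, hcd⟩
  have hA' := Finpartition.part_eq_of_mem _ hA ha
  have hB' := Finpartition.part_eq_of_mem _ hB hb
  have h := fun k : Fin n => hu.1 k k.2
  rw [← hA', mem_part_ofWord] at hc
  rw [← hB', mem_part_ofWord] at hd
  have := label_eq_of_crossing (h a) (h b) (h c) (h d) hab hbc hcd hc.symm hd.symm
  rw [← mem_part_ofWord, mem_part_iff] at this
  exact hAB (hA'.symm.trans (this.trans hB'))

theorem word_ofWord {u : Fin n → Bool × Bool} (hu : Admissible (extendWord u) n) :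
    (ofWord u).word = u := by
  funext j
  have h1 := first_iff hu.1 j.2
  have h2 := last_iff hu j.2
  rw [extendWord_coe] at h1 h2
  refine Prod.ext (Bool.eq_iff_iff.2 ?_) (Bool.eq_iff_iff.2 ?_)
  · rw [h1, word, decide_eq_true_iff]
    exact ⟨fun h i hi hij => h ⟨i, hi⟩ ((mem_part_ofWord u).2 hij),
      fun h i hi => h i i.2 ((mem_part_ofWord u).1 hi)⟩
  · rw [h2, word, decide_eq_true_iff]
    exact ⟨fun h i hi hij => h ⟨i, hi⟩ ((mem_part_ofWord u).2 hij),
      fun h i hi => h i i.2 ((mem_part_ofWord u).1 hi)⟩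

/-- The first element of the block of `i`. -/
def first (π : PartitionOf n) (i : Fin n) : Fin n := (π.part i).min' ⟨i, π.mem_part_self i⟩

theorem first_mem (π : PartitionOf n) (i : Fin n) : π.first i ∈ π.part i := Finset.min'_mem _ _

theorem first_le_of_mem (π : PartitionOf n) {i j : Fin n} (h : j ∈ π.part i) : π.first i ≤ j :=
  Finset.min'_le _ _ h

theorem first_le (π : PartitionOf n) (i : Fin n) : π.first i ≤ i :=
  π.first_le_of_mem (π.mem_part_self i)

theorem first_eq_iff (π : PartitionOf n) {i j : Fin n} :
    π.first i = π.first j ↔ π.part i = π.part j := by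
  constructor
  · intro h
    rw [← π.mem_part_iff.1 (π.first_mem i), h, π.mem_part_iff.1 (π.first_mem j)]
  · intro h
    simp only [first, h]

theorem eq_of_first_eq {π ρ : PartitionOf n} (h : ∀ i, π.first i = ρ.first i) : π = ρ := by
  have hp : ∀ i, π.part i = ρ.part i := fun i => by
    ext j
    rw [mem_part_iff, mem_part_iff, ← first_eq_iff, ← first_eq_iff, h, h]
  have hsub : ∀ {π ρ : PartitionOf n}, (∀ i, π.part i = ρ.part i) → π.parts ⊆ ρ.parts := by
    intro π ρ hp A hA
    obtain ⟨i, hi⟩ := π.nonempty_of_mem_parts hA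
    rw [← Finpartition.part_eq_of_mem π hA hi, hp]
    exact ρ.part_mem i
  exact Finpartition.ext ((hsub hp).antisymm (hsub fun i => (hp i).symm))

/-- `i` is the first element of a block that contains an element `≥ k`; for `i < k` this says that
the block is still open before `k` is read. -/
def IsOpenAt (π : PartitionOf n) (k : ℕ) (i : Fin n) : Prop :=
  π.first i = i ∧ ∃ j ∈ π.part i, k ≤ (j : ℕ)

theorem word_fst (π : PartitionOf n) (i : Fin n) : (π.word i).1 = true ↔ π.first i = i := by
  rw [word, decide_eq_true_iff]
  exact ⟨fun h => le_antisymm (π.first_le i) (h _ (π.first_mem i)),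
    fun h j hj => h ▸ π.first_le_of_mem hj⟩

theorem word_snd (π : PartitionOf n) (i : Fin n) :
    (π.word i).2 = true ↔ ∀ j ∈ π.part i, j ≤ i := by
  rw [word, decide_eq_true_iff]

/-- No block that reaches from before `k` to beyond `k` starts inside the block of `k`. -/
theorem IsNonCrossing.le_first {π : PartitionOf n} (hπ : π.IsNonCrossing) {i k : Fin n}
    (hik : i ≤ k) (hi : π.IsOpenAt k i) : i ≤ π.first k := by
  obtain ⟨hmin, j, hj, hkj⟩ := hi
  by_contra! hlt
  have hne : π.part k ≠ π.part i := fun h => by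
    rw [π.first_eq_iff.2 h, hmin] at hlt
    exact lt_irrefl _ hlt
  have hik' : i < k := lt_of_le_of_ne hik fun h => hne (by rw [h])
  have hkj' : k < j := lt_of_le_of_ne hkj fun h => hne (by rw [h]; exact π.mem_part_iff.1 hj)
  exact hπ _ (π.part_mem k) _ (π.part_mem i) hne
    ⟨_, π.first_mem k, k, π.mem_part_self k, i, π.mem_part_self i, j, hj, hlt, hik', hkj'⟩

theorem isOpenAt_first (π : PartitionOf n) (k : Fin n) : π.IsOpenAt k (π.first k) :=
  ⟨π.first_eq_iff.2 (π.mem_part_iff.1 (π.first_mem k)), k,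
    π.mem_part_iff.2 (π.mem_part_iff.1 (π.first_mem k)).symm, le_rfl⟩

theorem mem_active_word_of {π : PartitionOf n} {k : Fin n}
    (hs : ∀ i : ℕ, i ∈ stack (extendWord π.word) k ↔
      ∃ h : i < n, i < k ∧ π.IsOpenAt k ⟨i, h⟩) (i : ℕ) :
    i ∈ active (extendWord π.word) k ↔ ∃ h : i < n, i ≤ k ∧ π.IsOpenAt k ⟨i, h⟩ := by
  rw [mem_active_iff, hs, extendWord_coe, word_fst]
  constructor
  · rintro (⟨h, h1, h2⟩ | ⟨rfl, h⟩)
    · exact ⟨h, h1.le, h2⟩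
    · exact ⟨k.2, le_rfl, h, k, π.mem_part_self k, le_rfl⟩
  · rintro ⟨h, h1, h2⟩
    rcases h1.lt_or_eq with h1 | rfl
    · exact Or.inl ⟨h, h1, h2⟩
    · exact Or.inr ⟨rfl, h2.1⟩

theorem label_word_of {π : PartitionOf n} (hπ : π.IsNonCrossing) {k : Fin n}
    (hs : ∀ i : ℕ, i ∈ active (extendWord π.word) k ↔
      ∃ h : i < n, i ≤ k ∧ π.IsOpenAt k ⟨i, h⟩) :
    active (extendWord π.word) k ≠ [] ∧ label (extendWord π.word) k = π.first k := by
  have hmem : (π.first k : ℕ) ∈ active (extendWord π.word) k :=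
    (hs _).2 ⟨(π.first k).2, π.first_le k, π.isOpenAt_first k⟩
  have hne := List.ne_nil_of_mem hmem
  refine ⟨hne, le_antisymm ?_ (le_label hmem)⟩
  obtain ⟨h, h1, h2⟩ := (hs _).1 (label_mem hne)
  exact hπ.le_first (i := ⟨_, h⟩) h1 h2

/-- Reading the word of a non-crossing partition, the stack before position `k` consists of the
blocks with elements both before and not before `k`. -/
theorem IsNonCrossing.mem_stack_word {π : PartitionOf n} (hπ : π.IsNonCrossing) {k : ℕ}
    (hk : k ≤ n) (i : ℕ) : i ∈ stack (extendWord π.word) k ↔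
      ∃ h : i < n, i < k ∧ π.IsOpenAt k ⟨i, h⟩ := by
  induction k generalizing i with
  | zero => simp [stack]
  | succ k ih =>
    set k' : Fin n := ⟨k, hk⟩
    have ha := mem_active_word_of (π := π) (k := k') (ih (Nat.le_of_succ_le hk))
    have hl := (label_word_of hπ ha).2
    have hw := extendWord_coe π.word k'
    change extendWord π.word k = _ at hw
    change label (extendWord π.word) k = _ at hl
    rw [mem_stack_succ_iff, hl, hw, word_snd]
    refine (and_congr_left' (ha i)).trans ⟨?_, ?_⟩
    · rintro ⟨⟨h, h1, hmin, j, hj, hkj⟩, h2⟩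
      refine ⟨h, Nat.lt_succ_of_le h1, hmin, ?_⟩
      by_contra! hcon
      have hjk : j = k' := Fin.ext (le_antisymm (Nat.le_of_lt_succ (hcon j hj)) hkj)
      have hpart : π.part k' = π.part ⟨i, h⟩ := π.mem_part_iff.1 (hjk ▸ hj)
      refine h2 (fun l hl => Nat.le_of_lt_succ (hcon l (hpart ▸ hl))) ?_
      rw [π.first_eq_iff.2 hpart, hmin]
    · rintro ⟨h, h1, hmin, j, hj, hkj⟩
      refine ⟨⟨h, Nat.le_of_lt_succ h1, hmin, j, hj, Nat.le_of_succ_le hkj⟩, fun h2 heq => ?_⟩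
      have hfin : (⟨i, h⟩ : Fin n) = π.first k' := Fin.ext heq
      have hpart : π.part ⟨i, h⟩ = π.part k' := by
        rw [hfin, π.mem_part_iff.1 (π.first_mem k')]
      exact absurd (h2 j (hpart ▸ hj)) (not_le.2 hkj)

theorem IsNonCrossing.mem_active_word {π : PartitionOf n} (hπ : π.IsNonCrossing) (k : Fin n)
    (i : ℕ) : i ∈ active (extendWord π.word) k ↔ ∃ h : i < n, i ≤ k ∧ π.IsOpenAt k ⟨i, h⟩ :=
  mem_active_word_of (hπ.mem_stack_word k.2.le) i

theorem IsNonCrossing.label_word {π : PartitionOf n} (hπ : π.IsNonCrossing) (k : Fin n) :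
    label (extendWord π.word) k = π.first k :=
  (label_word_of hπ (hπ.mem_active_word k)).2

theorem IsNonCrossing.admissible_word {π : PartitionOf n} (hπ : π.IsNonCrossing) :
    Admissible (extendWord π.word) n := by
  refine ⟨fun k hk => (label_word_of (k := ⟨k, hk⟩) hπ (hπ.mem_active_word _)).1, ?_⟩
  refine List.eq_nil_iff_forall_not_mem.2 fun i hi => ?_
  obtain ⟨h, -, -, j, -, hj⟩ := (hπ.mem_stack_word le_rfl i).1 hi
  exact absurd j.2 (not_lt.2 hj)

theorem IsNonCrossing.eq_of_word_eq {π ρ : PartitionOf n} (hπ : π.IsNonCrossing)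
    (hρ : ρ.IsNonCrossing) (h : π.word = ρ.word) : π = ρ :=
  eq_of_first_eq fun i => Fin.ext (by rw [← hπ.label_word, ← hρ.label_word, h])

theorem mem_NC {π : PartitionOf n} : π ∈ NC n ↔ π.IsNonCrossing := by
  simp [NC]

/-- Non-crossing partitions correspond to admissible words. -/
theorem sum_NC_eq_sum_word {M : Type*} [AddCommMonoid M] (f : (Fin n → Bool × Bool) → M)
    (hf : ∀ u, ¬ Admissible (extendWord u) n → f u = 0) :
    ∑ π ∈ NC n, f π.word = ∑ u, f u := by
  classical
  rw [← Finset.sum_filter_of_ne (p := fun u => Admissible (extendWord u) n)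
    fun u _ h => by_contra fun h' => h (hf u h')]
  refine Finset.sum_bij (fun π _ => π.word) (fun π hπ => ?_) (fun π hπ ρ hρ h => ?_)
    (fun u hu => ?_) fun π _ => rfl
  · exact Finset.mem_filter.2
      ⟨Finset.mem_univ _, IsNonCrossing.admissible_word (mem_NC.1 hπ)⟩
  · exact IsNonCrossing.eq_of_word_eq (mem_NC.1 hπ) (mem_NC.1 hρ) h
  · have hu' := (Finset.mem_filter.1 hu).2
    exact ⟨ofWord u, mem_NC.2 (ofWord_isNonCrossing hu'),
      word_ofWord hu'⟩

end PartitionOf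

/-! ### Moments as sums over words -/

theorem FockMultiplier.adjoint_op (g : FockMultiplier) :
    ContinuousLinearMap.adjoint g.op = g.op := by
  refine ContinuousLinearMap.ext fun F => ext_inner_right ℂ fun G => ?_
  rw [ContinuousLinearMap.adjoint_inner_left, lp.inner_eq_tsum, lp.inner_eq_tsum]
  refine tsum_congr fun n => ?_
  rw [g.op_apply, g.op_apply, L2.inner_def, L2.inner_def]
  refine integral_congr_ae ?_
  filter_upwards [g.coeFn_component n (F n), g.coeFn_component n (G n)] with x h1 h2
  rw [h1, h2]
  simp only [RCLike.inner_apply, map_mul, Complex.conj_ofReal]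
  ring

/-- `a_t^* m_t = a_t^*`, the adjoint of `m_t a_t = a_t`. This makes `γ_t` equal to
`(1 + a_t^*) (a_t + m_t)`. -/
theorem adjoint_creation_mul_gaugeOp (k : Coupling) (t : ℝ) :
    ContinuousLinearMap.adjoint (k.creation (chi t)) * gaugeOp t =
      ContinuousLinearMap.adjoint (k.creation (chi t)) := by
  have h : gaugeOp t * k.creation (chi t) = k.creation (chi t) := by
    rw [← BoundedFn.vec_one]
    exact ContinuousLinearMap.ext fun F => gaugeOp_creation k t _ F
  have h2 := congrArg ContinuousLinearMap.adjoint h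
  rw [ContinuousLinearMap.mul_def, ContinuousLinearMap.adjoint_comp, gaugeOp,
    FockMultiplier.adjoint_op] at h2
  exact h2

section

variable (p q t : ℝ)

/-- The summand of `γ_t = (1 + a_t^*) (a_t + m_t)` that belongs to a letter. -/
noncomputable def letterOp (x : Bool × Bool) : FockSpace →L[ℂ] FockSpace :=
  (if x.2 then ContinuousLinearMap.adjoint (pqCreation p q (chi t)) else 1) *
    if x.1 then pqCreation p q (chi t) else gaugeOp t

theorem sum_letterOp : ∑ x, letterOp p q t x = pqPoisson p q t := by
  have h := adjoint_creation_mul_gaugeOp (pqCoupling p q) t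
  change ContinuousLinearMap.adjoint (pqCreation p q (chi t)) * gaugeOp t =
    ContinuousLinearMap.adjoint (pqCreation p q (chi t)) at h
  rw [Fintype.sum_prod_type]
  simp only [Fintype.sum_bool, letterOp, if_true, Bool.false_eq_true, if_false, one_mul, h]
  unfold pqPoisson
  abel

/-- The vector obtained from the vacuum by applying the operators of the first `k` letters. -/
noncomputable def wordVec (u : ℕ → Bool × Bool) : ℕ → FockSpace
  | 0 => vacuum
  | k + 1 => letterOp p q t (u k) (wordVec u k)

theorem wordVec_congr {u v : ℕ → Bool × Bool} (k : ℕ) (h : ∀ i < k, u i = v i) :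
    wordVec p q t u k = wordVec p q t v k := by
  induction k with
  | zero => rfl
  | succ k ih =>
    rw [wordVec, wordVec, h k (Nat.lt_succ_self k),
      ih fun i hi => h i (hi.trans (Nat.lt_succ_self k))]

theorem pqPoisson_pow_vacuum (n : ℕ) :
    (pqPoisson p q t ^ n) vacuum = ∑ u : Fin n → Bool × Bool, wordVec p q t (extendWord u) n := by
  induction n with
  | zero => simp [wordVec]
  | succ n ih =>
    have hsplit : ∑ u : Fin (n + 1) → Bool × Bool, wordVec p q t (extendWord u) (n + 1) =
        ∑ u : Fin n → Bool × Bool, ∑ x : Bool × Bool, wordVec p q t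
          (extendWord (Fin.snocEquiv (fun _ : Fin (n + 1) => Bool × Bool) (x, u))) (n + 1) := by
      rw [← (Fin.snocEquiv fun _ : Fin (n + 1) => Bool × Bool).sum_comp, Fintype.sum_prod_type,
        Finset.sum_comm]
    rw [hsplit, pow_succ', mul_apply_eq_comp, ih, map_sum]
    refine Fintype.sum_congr _ _ fun u => ?_
    rw [← sum_letterOp, sum_apply]
    refine Fintype.sum_congr _ _ fun x => ?_
    have h1 : extendWord (Fin.snocEquiv (fun _ : Fin (n + 1) => Bool × Bool) (x, u)) n = x := by
      simp [extendWord, Fin.snocEquiv, Fin.snoc]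
    have h2 : ∀ i < n, extendWord u i =
        extendWord (Fin.snocEquiv (fun _ : Fin (n + 1) => Bool × Bool) (x, u)) i := by
      intro i hi
      simp [extendWord, Fin.snocEquiv, Fin.snoc, hi, hi.trans (Nat.lt_succ_self n)]
    rw [wordVec, h1, wordVec_congr p q t n h2]

/-- The vector `f₁ ⊛ ⋯ ⊛ fₘ = a(f₁) ⋯ a(fₘ) Ω`, with all functions restricted to `[0, t]`. -/
noncomputable def productVec : List BoundedFn → FockSpace
  | [] => vacuum
  | f :: fs => pqCreation p q (f.vec t) (productVec fs)

/-- The product `f₁(s_{i₁}) ⋯ fₘ(s_{iₘ})`, for two lists of the same length. -/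
def evalProd : List BoundedFn → List ℕ → (ℕ → ℝ) → ℝ
  | f :: fs, i :: is, s => f (s i) * evalProd fs is s
  | _, _, _ => 1

/-- The weight `w(s_i, s_j)` of closing the block `i` on top of the stack, where `j` is the next
block on the stack, if there is one. -/
noncomputable def edgeWeight : List ℕ → (ℕ → ℝ) → ℝ
  | i :: j :: _, s => pqWeight p q (s i) (s j)
  | _, _ => 1

/-- The product of the weights of all blocks closed before position `k`. -/
noncomputable def wordWeight (u : ℕ → Bool × Bool) (k : ℕ) (s : ℕ → ℝ) : ℝ :=
  ∏ i ∈ Finset.range k, if (u i).2 then edgeWeight p q (active u i) s else 1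

end

theorem evalProd_update (fs : List BoundedFn) (is : List ℕ) (s : ℕ → ℝ) (i : ℕ) (y : ℝ)
    (hi : i ∉ is) : evalProd fs is (Function.update s i y) = evalProd fs is s := by
  induction fs generalizing is with
  | nil => rfl
  | cons f fs ih =>
    cases is with
    | nil => rfl
    | cons j is =>
      rw [List.mem_cons, not_or] at hi
      rw [evalProd, evalProd, ih is hi.2, Function.update_of_ne (Ne.symm hi.1)]

theorem evalProd_nonneg (fs : List BoundedFn) (is : List ℕ) (s : ℕ → ℝ) :
    0 ≤ evalProd fs is s := by
  induction fs generalizing is with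
  | nil => exact zero_le_one
  | cons f fs ih =>
    cases is with
    | nil => exact zero_le_one
    | cons j is => exact mul_nonneg (f.nonneg _) (ih is)

theorem measurable_edgeWeight (p q : ℝ) (l : List ℕ) : Measurable (edgeWeight p q l) := by
  match l with
  | [] => exact measurable_const
  | [_] => exact measurable_const
  | i :: j :: _ =>
    have h : Measurable fun s : ℕ → ℝ => (s i, s j) :=
      (measurable_pi_apply i).prodMk (measurable_pi_apply j)
    exact (measurable_pqWeight p q).comp h

theorem edgeWeight_nonneg {p q : ℝ} (hp : 0 ≤ p) (hq : 0 ≤ q) (l : List ℕ) (s : ℕ → ℝ) :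
    0 ≤ edgeWeight p q l s := by
  match l with
  | [] => exact zero_le_one
  | [_] => exact zero_le_one
  | i :: j :: _ => exact pqWeight_nonneg hp hq _ _

theorem edgeWeight_congr (p q : ℝ) (l : List ℕ) {s s' : ℕ → ℝ} (h : ∀ i ∈ l, s i = s' i) :
    edgeWeight p q l s = edgeWeight p q l s' := by
  match l with
  | [] => rfl
  | [_] => rfl
  | i :: j :: _ => simp only [edgeWeight, h i (by simp), h j (by simp)]

theorem measurable_wordWeight (p q : ℝ) (u : ℕ → Bool × Bool) (k : ℕ) :
    Measurable (wordWeight p q u k) := by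
  unfold wordWeight
  refine Finset.measurable_fun_prod _ fun i _ => ?_
  split_ifs
  · exact measurable_edgeWeight p q _
  · exact measurable_const

theorem wordWeight_succ (p q : ℝ) (u : ℕ → Bool × Bool) (k : ℕ) (s : ℕ → ℝ) :
    wordWeight p q u (k + 1) s =
      wordWeight p q u k s * if (u k).2 then edgeWeight p q (active u k) s else 1 :=
  Finset.prod_range_succ _ _

/-- The measure on the variable attached to a block: Lebesgue measure on `[0, t]`. -/
noncomputable abbrev segmentMeasure (t : ℝ) : Measure ℝ := volume.restrict (Set.Icc (0 : ℝ) t)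

/-- A factor that does not depend on the integrated variables can be taken out of the integral. -/
theorem lmarginal_mul_of_congr {μ : ℕ → Measure ℝ} {C : Finset ℕ} {E W : (ℕ → ℝ) → ℝ≥0∞}
    (hW : Measurable W) (hE : ∀ s s' : ℕ → ℝ, (∀ i ∉ C, s i = s' i) → E s = E s') (s : ℕ → ℝ) :
    (∫⋯∫⁻_C, (fun s => E s * W s) ∂μ) s = E s * (∫⋯∫⁻_C, W ∂μ) s := by
  unfold lmarginal
  have hm : Measurable fun y : C → ℝ => W (Function.updateFinset s C y) :=
    hW.comp measurable_updateFinset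
  rw [← lintegral_const_mul _ hm]
  refine lintegral_congr fun y => ?_
  change E _ * W _ = _
  rw [hE (Function.updateFinset s C y) s fun i hi => by simp [Function.updateFinset, hi]]

/-- The positions before `k` at which a block is opened. -/
def openings (u : ℕ → Bool × Bool) (k : ℕ) : Finset ℕ := (Finset.range k).filter fun i => (u i).1

/-- Closing the block on top of the stack: on the Fock space, and in the product of weights. -/
theorem exists_close {p q : ℝ} (hp : 0 ≤ p) (hq : 0 ≤ q) (t : ℝ) (f : BoundedFn)
    (fs : List BoundedFn) (i : ℕ) (is : List ℕ)
    (hlen : fs.length = is.length) (hi : i ∉ is) : ∃ (c : ℝ) (gs : List BoundedFn), 0 ≤ c ∧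
      gs.length = is.length ∧
      ContinuousLinearMap.adjoint (pqCreation p q (chi t)) (productVec p q t (f :: fs)) =
        (c : ℂ) • productVec p q t gs ∧
      ∀ s, ∫⁻ y, ENNReal.ofReal (edgeWeight p q (i :: is) (Function.update s i y) *
        evalProd (f :: fs) (i :: is) (Function.update s i y)) ∂segmentMeasure t =
        ENNReal.ofReal (c * evalProd gs is s) := by
  rw [productVec, pqCreation_adjoint_mul hp hq]
  cases fs with
  | nil =>
    obtain rfl : is = [] := List.length_eq_zero_iff.1 hlen.symm
    refine ⟨∫ s in Set.Icc (0 : ℝ) t, f s, [], integral_nonneg f.nonneg, rfl, ?_, fun s => ?_⟩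
    · rw [productVec, FockMultiplier.op_vacuum _ _ fun x => rfl]
    · simp only [edgeWeight, evalProd, Function.update_self, one_mul, mul_one]
      rw [ofReal_integral_eq_lintegral_ofReal (f.integrableOn t)
        (Filter.Eventually.of_forall f.nonneg)]
  | cons g gs =>
    cases is with
    | nil => simp at hlen
    | cons j is =>
      have hij : j ≠ i := fun h => hi (by simp [h])
      refine ⟨1, (f.smear hp hq t).mul g :: gs, zero_le_one, hlen, ?_, fun s => ?_⟩
      · rw [productVec, pqCreation, firstMultiplier_op_creation, Complex.ofReal_one, one_smul]
        rfl
      · have h1 := integrable_pqWeight_mul hp hq t f (s j)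
        have h2 : 0 ≤ g (s j) * evalProd gs is s :=
          mul_nonneg (g.nonneg _) (evalProd_nonneg _ _ _)
        have h3 : ∀ y, edgeWeight p q (i :: j :: is) (Function.update s i y) *
            evalProd (f :: g :: gs) (i :: j :: is) (Function.update s i y) =
            pqWeight p q y (s j) * f y * (g (s j) * evalProd gs is s) := fun y => by
          rw [evalProd, evalProd_update _ _ _ _ _ hi]
          simp only [edgeWeight, evalProd, Function.update_self, Function.update_of_ne hij]
          ring
        simp only [h3]
        rw [← ofReal_integral_eq_lintegral_ofReal (h1.mul_const _)
          (Filter.Eventually.of_forall fun y =>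
            mul_nonneg (mul_nonneg (pqWeight_nonneg hp hq _ _) (f.nonneg y)) h2),
          integral_mul_const]
        congr 1
        simp only [evalProd, BoundedFn.mul, BoundedFn.smear]
        ring

/-- After `k` letters the Fock space vector is a multiple of a product vector with one factor for
each open block, and the factors are the weights integrated over the variables of the blocks closed
so far. -/
theorem exists_wordVec_eq {p q : ℝ} (hp : 0 ≤ p) (hq : 0 ≤ q) (t : ℝ)
    (u : ℕ → Bool × Bool) (k : ℕ) (hu : ∀ j < k, active u j ≠ []) :
    ∃ (c : ℝ) (fs : List BoundedFn), 0 ≤ c ∧ fs.length = (stack u k).length ∧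
      wordVec p q t u k = (c : ℂ) • productVec p q t fs ∧
      ∀ s, (∫⋯∫⁻_(openings u k \ (stack u k).toFinset),
        (fun s => ENNReal.ofReal (wordWeight p q u k s)) ∂fun _ => segmentMeasure t) s =
          ENNReal.ofReal (c * evalProd fs (stack u k) s) := by
  induction k with
  | zero =>
    exact ⟨1, [], zero_le_one, rfl, by simp [wordVec, productVec], fun s => by
      simp [openings, wordWeight, evalProd]⟩
  | succ k ih =>
    obtain ⟨c, fs, hc, hlen, hvec, hint⟩ := ih fun j hj => hu j (hj.trans (Nat.lt_succ_self k))
    have hW : Measurable fun s => ENNReal.ofReal (wordWeight p q u k s) :=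
      (measurable_wordWeight p q u k).ennreal_ofReal
    have hne := hu k (Nat.lt_succ_self k)
    -- the effect of opening a block, or of continuing the block on top of the stack
    obtain ⟨gs, glen, gvec, gint⟩ : ∃ gs : List BoundedFn, gs.length = (active u k).length ∧
        (if (u k).1 then pqCreation p q (chi t) else gaugeOp t) (wordVec p q t u k) =
          (c : ℂ) • productVec p q t gs ∧
        ∀ s, (∫⋯∫⁻_(openings u (k + 1) \ (active u k).toFinset),
          (fun s => ENNReal.ofReal (wordWeight p q u k s)) ∂fun _ => segmentMeasure t) s =
            ENNReal.ofReal (c * evalProd gs (active u k) s) := by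
      by_cases h : (u k).1 = true
      · have hact : active u k = k :: stack u k := by simp [active, h]
        have hset : openings u (k + 1) \ (active u k).toFinset =
            openings u k \ (stack u k).toFinset := by
          ext i
          simp only [openings, hact, Finset.mem_sdiff, Finset.mem_filter, Finset.mem_range,
            List.mem_toFinset, List.mem_cons]
          constructor
          · rintro ⟨⟨h1, h2⟩, h3⟩
            exact ⟨⟨by omega, h2⟩, fun h4 => h3 (Or.inr h4)⟩
          · rintro ⟨⟨h1, h2⟩, h3⟩
            exact ⟨⟨by omega, h2⟩, fun h4 => h4.elim (by omega) h3⟩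
        refine ⟨BoundedFn.one :: fs, by simp [hact, hlen], ?_, fun s => ?_⟩
        · rw [if_pos h, hvec, map_smul, productVec, BoundedFn.vec_one]
        · rw [hset, hint, hact, evalProd]
          simp [BoundedFn.one]
      · have hact : active u k = stack u k := by simp [active, h]
        have hset : openings u (k + 1) = openings u k := by
          simp [openings, Finset.range_add_one, Finset.filter_insert, h]
        refine ⟨fs, by rw [hact, hlen], ?_, fun s => by rw [hact, hset, hint]⟩
        rw [if_neg h, hvec, map_smul]
        cases fs with
        | nil =>
          rw [hact] at hne
          exact absurd (List.length_eq_zero_iff.1 hlen.symm) hne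
        | cons f fs => rw [productVec, pqCreation, gaugeOp_creation]
    by_cases h : (u k).2 = true
    · -- the effect of closing the block on top of the stack
      have hact := active_eq_cons hne
      set i := label u k with hi_def
      set is := (active u k).tail with his
      have hi : i ∉ is := fun h' => (mem_active_tail_iff.1 h').2 rfl
      have hstack : stack u (k + 1) = is := by rw [stack_succ, if_pos h]
      cases gs with
      | nil => rw [hact] at glen; simp at glen
      | cons g gs =>
        rw [hact, List.length_cons, List.length_cons, Nat.add_right_cancel_iff] at glen
        obtain ⟨d, hs, hd, hslen, hsvec, hsint⟩ := exists_close hp hq t g gs i is glen hi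
        refine ⟨c * d, hs, mul_nonneg hc hd, by rw [hslen, hstack], ?_, fun s => ?_⟩
        · rw [wordVec, letterOp, mul_apply_eq_comp, gvec, if_pos h, map_smul, hsvec,
            smul_smul, Complex.ofReal_mul]
        · have hmem : i ∈ openings u (k + 1) := by
            have := active_spec u k i (label_mem hne)
            exact Finset.mem_filter.2 ⟨Finset.mem_range.2 (Nat.lt_succ_of_le this.1), this.2⟩
          have hset : openings u (k + 1) \ is.toFinset =
              insert i (openings u (k + 1) \ (active u k).toFinset) := by
            rw [hact, List.toFinset_cons, Finset.sdiff_insert,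
              Finset.insert_erase (Finset.mem_sdiff.2 ⟨hmem, by simpa using hi⟩)]
          have hnot : i ∉ openings u (k + 1) \ (active u k).toFinset := by
            rw [hact]; simp
          have hfun : (fun s => ENNReal.ofReal (wordWeight p q u (k + 1) s)) = fun s =>
              ENNReal.ofReal (edgeWeight p q (active u k) s) *
                ENNReal.ofReal (wordWeight p q u k s) := by
            funext s
            rw [wordWeight_succ, if_pos h, mul_comm,
              ENNReal.ofReal_mul (edgeWeight_nonneg hp hq _ _)]
          have hmeas : Measurable fun s => ENNReal.ofReal (edgeWeight p q (active u k) s) *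
              ENNReal.ofReal (wordWeight p q u k s) :=
            (measurable_edgeWeight p q _).ennreal_ofReal.mul hW
          rw [hstack, hset, hfun, lmarginal_insert _ hmeas hnot]
          have hE : ∀ s s' : ℕ → ℝ,
              (∀ j ∉ openings u (k + 1) \ (active u k).toFinset, s j = s' j) →
              ENNReal.ofReal (edgeWeight p q (active u k) s) =
                ENNReal.ofReal (edgeWeight p q (active u k) s') := fun s s' hss => by
            rw [edgeWeight_congr p q _ fun j hj => hss j (by simp [hj])]
          simp only [lmarginal_mul_of_congr hW hE, gint]
          rw [mul_assoc, ENNReal.ofReal_mul hc, ← hsint, ← lintegral_const_mul']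
          · refine lintegral_congr fun y => ?_
            rw [← ENNReal.ofReal_mul (edgeWeight_nonneg hp hq _ _), ← ENNReal.ofReal_mul hc, ← hact]
            congr 1
            ring
          · exact ENNReal.ofReal_ne_top
    · have hstack : stack u (k + 1) = active u k := by rw [stack_succ, if_neg h]
      refine ⟨c, gs, hc, by rw [glen, hstack], ?_, fun s => ?_⟩
      · rw [wordVec, letterOp, mul_apply_eq_comp, gvec, if_neg h]
        rfl
      · simp only [hstack, wordWeight_succ, if_neg h, mul_one, gint]

theorem inner_vacuum_wordVec {p q : ℝ} (hp : 0 ≤ p) (hq : 0 ≤ q) (t : ℝ)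
    {u : ℕ → Bool × Bool} {n : ℕ} (hu : Admissible u n) (s : ℕ → ℝ) :
    inner ℂ vacuum (wordVec p q t u n) = (((∫⋯∫⁻_(openings u n),
      (fun s => ENNReal.ofReal (wordWeight p q u n s))
        ∂fun _ => segmentMeasure t) s).toReal : ℂ) := by
  obtain ⟨c, fs, hc, hlen, hvec, hint⟩ := exists_wordVec_eq hp hq t u n hu.1
  rw [hu.2] at hlen hint
  obtain rfl : fs = [] := List.length_eq_zero_iff.1 hlen
  have := hint s
  simp only [List.toFinset_nil, Finset.sdiff_empty] at this
  rw [hvec, this, inner_smul_right, productVec, inner_vacuum_self]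
  simp [evalProd, hc]

theorem inner_vacuum_wordVec_of_not {p q : ℝ} (hp : 0 ≤ p) (hq : 0 ≤ q) (t : ℝ)
    {u : ℕ → Bool × Bool} {n : ℕ} (hu : ¬ Admissible u n) :
    inner ℂ vacuum (wordVec p q t u n) = 0 := by
  classical
  by_cases h : ∀ k < n, active u k ≠ []
  · obtain ⟨c, fs, -, hlen, hvec, -⟩ := exists_wordVec_eq hp hq t u n h
    cases fs with
    | nil => exact absurd ⟨h, List.length_eq_zero_iff.1 hlen.symm⟩ hu
    | cons f fs =>
      rw [hvec, inner_smul_right, productVec, pqCreation, inner_vacuum_creation, mul_zero]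
  · -- at the first reading from an empty stack, the operator annihilates the vacuum
    push Not at h
    have hk := Nat.find_spec h
    have hmin : ∀ j < Nat.find h, active u j ≠ [] := fun j hj hj' =>
      Nat.find_min h hj ⟨hj.trans hk.1, hj'⟩
    set k := Nat.find h
    have h1 : (u k).1 = false := by
      by_contra hcon
      have := hk.2
      simp [active, Bool.eq_true_of_not_eq_false hcon] at this
    have h2 : stack u k = [] := by
      have := hk.2
      simpa [active, h1] using this
    have hzero : wordVec p q t u (k + 1) = 0 := by
      obtain ⟨c, fs, -, hlen, hvec, -⟩ := exists_wordVec_eq hp hq t u k hmin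
      rw [h2] at hlen
      obtain rfl : fs = [] := List.length_eq_zero_iff.1 hlen
      rw [wordVec, hvec, map_smul, letterOp, h1, mul_apply_eq_comp, productVec]
      simp [gaugeOp_vacuum]
    have hall : ∀ m, k + 1 ≤ m → wordVec p q t u m = 0 := by
      intro m hm
      induction m, hm using Nat.le_induction with
      | base => exact hzero
      | succ m hm ih => rw [wordVec, ih, map_zero]
    rw [hall n hk.1, inner_zero_right]

/-- The moments of the process, as a sum of integrals over non-crossing partitions. -/
theorem vacuumState_pqPoisson_pow {p q : ℝ} (hp : 0 ≤ p) (hq : 0 ≤ q) (t : ℝ) (n : ℕ) (s : ℕ → ℝ) :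
    vacuumState (pqPoisson p q t ^ n) = ((∑ π ∈ NC n, ((∫⋯∫⁻_(openings (extendWord π.word) n),
      (fun s => ENNReal.ofReal (wordWeight p q (extendWord π.word) n s))
        ∂fun _ => segmentMeasure t) s).toReal : ℝ) : ℂ) := by
  rw [vacuumState, pqPoisson_pow_vacuum, inner_sum,
    ← PartitionOf.sum_NC_eq_sum_word
      (fun u => inner ℂ vacuum (wordVec p q t (extendWord u) n))
      fun u hu => inner_vacuum_wordVec_of_not hp hq t hu, Complex.ofReal_sum]
  classical
  exact Finset.sum_congr rfl fun π hπ => inner_vacuum_wordVec hp hq t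
    (PartitionOf.mem_NC.1 hπ).admissible_word s

/-! ### Integration over orderings -/

/-- Almost all points have pairwise distinct coordinates. -/
theorem ae_injective_pi_restrict {ι : Type*} [Fintype ι] (S : Set ℝ) :
    ∀ᵐ y ∂Measure.pi fun _ : ι => volume.restrict S, Function.Injective y := by
  classical
  have hpair : ∀ᵐ y : ι → ℝ ∂volume, ∀ i j, i ≠ j → y i ≠ y j := by
    refine ae_all_iff.2 fun i => ae_all_iff.2 fun j => ?_
    by_cases hij : i = j
    · exact Filter.Eventually.of_forall fun y h => absurd hij h
    · have hne : LinearMap.ker (LinearMap.proj (R := ℝ) (φ := fun _ : ι => ℝ) i -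
          LinearMap.proj (R := ℝ) (φ := fun _ : ι => ℝ) j) ≠ ⊤ := fun h => by
        have : Pi.single i (1 : ℝ) ∈ LinearMap.ker
            (LinearMap.proj (R := ℝ) (φ := fun _ : ι => ℝ) i -
              LinearMap.proj (R := ℝ) (φ := fun _ : ι => ℝ) j) := h ▸ Submodule.mem_top
        simp [LinearMap.mem_ker, Ne.symm hij] at this
      have h0 := Measure.addHaar_submodule (volume : Measure (ι → ℝ)) _ hne
      rw [measure_eq_zero_iff_ae_notMem] at h0
      filter_upwards [h0] with y hy _ h
      exact hy (by simp [LinearMap.mem_ker, h])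
  rw [← Measure.restrict_pi_pi]
  refine ae_restrict_of_ae ?_
  filter_upwards [hpair] with y hy i j h
  by_contra hij
  exact hy i j hij h

theorem ae_pi_of_ae {ι : Type*} [Fintype ι] {μ : Measure ℝ} [SigmaFinite μ] {P : ℝ → Prop}
    (h : ∀ᵐ x ∂μ, P x) : ∀ᵐ y ∂Measure.pi fun _ : ι => μ, ∀ i, P (y i) :=
  ae_all_iff.2 fun _ => Measure.tendsto_eval_ae_ae.eventually h

theorem ae_segmentMeasure_pos (t : ℝ) : ∀ᵐ x ∂segmentMeasure t, 0 < x := by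
  have h0 : ∀ᵐ x ∂segmentMeasure t, x ≠ 0 := Measure.ae_ne _ 0
  filter_upwards [ae_restrict_mem measurableSet_Icc, h0] with x hx h
  exact lt_of_le_of_ne hx.1 (Ne.symm h)

theorem existsUnique_strictMono_comp {ι : Type*} [Fintype ι] {b : ℕ} (e : Fin b ≃ ι) {y : ι → ℝ}
    (hy : Function.Injective y) : ∃! σ : Fin b ≃ ι, StrictMono (y ∘ σ) := by
  refine ⟨(Tuple.sort (y ∘ e)).trans e, ?_, fun τ hτ => ?_⟩
  · exact (Tuple.monotone_sort (y ∘ e)).strictMono_of_injective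
      (hy.comp ((Tuple.sort (y ∘ e)).trans e).injective)
  · have h1 : StrictMono (y ∘ (Tuple.sort (y ∘ e)).trans e) :=
      (Tuple.monotone_sort (y ∘ e)).strictMono_of_injective
        (hy.comp ((Tuple.sort (y ∘ e)).trans e).injective)
    have h2 := (StrictMono.range_inj hτ h1).1 (by
      rw [Set.range_comp, Set.range_comp, τ.surjective.range_eq, Equiv.range_eq_univ])
    exact Equiv.ext fun i => hy (congrFun h2 i)

theorem measurableSet_strictMono {ι : Type*} {b : ℕ} (σ : Fin b → ι) :
    MeasurableSet {y : ι → ℝ | StrictMono (y ∘ σ)} := by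
  have h : {y : ι → ℝ | StrictMono (y ∘ σ)} =
      ⋂ i, ⋂ j, ⋂ (_ : i < j), {y : ι → ℝ | y (σ i) < y (σ j)} := by
    ext y
    simp only [Set.mem_ofPred_eq, Set.mem_iInter]
    exact ⟨fun h i j hij => h hij, fun h i j hij => h i j hij⟩
  rw [h]
  exact MeasurableSet.iInter fun i => MeasurableSet.iInter fun j => MeasurableSet.iInter fun _ =>
    measurableSet_lt (measurable_pi_apply _) (measurable_pi_apply _)

/-- Integration of a function which depends only on the relative order of the coordinates: all
orders are equally likely. -/
theorem lintegral_eq_sum_mul {ι : Type*} [Fintype ι] {b : ℕ} (t : ℝ) (e : Fin b ≃ ι)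
    (f : (ι → ℝ) → ℝ≥0∞) (c : (Fin b ≃ ι) → ℝ≥0∞)
    (hf : ∀ y σ, (∀ i, 0 < y i) → StrictMono (y ∘ (σ : Fin b ≃ ι)) → f y = c σ) :
    ∫⁻ y, f y ∂Measure.pi (fun _ : ι => segmentMeasure t) =
      ∑ᶠ σ, c σ * Measure.pi (fun _ : Fin b => segmentMeasure t) {y | StrictMono y} := by
  classical
  have hfin : Fintype (Fin b ≃ ι) := Fintype.ofFinite _
  have hae : f =ᵐ[Measure.pi fun _ : ι => segmentMeasure t]
      fun y => ∑ σ : Fin b ≃ ι, {y : ι → ℝ | StrictMono (y ∘ σ)}.indicator (fun _ => c σ) y := by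
    filter_upwards [ae_injective_pi_restrict (ι := ι) (Set.Icc 0 t),
      ae_pi_of_ae (ae_segmentMeasure_pos t)] with y hy hpos
    obtain ⟨σ, hσ, huniq⟩ := existsUnique_strictMono_comp e hy
    rw [Finset.sum_eq_single_of_mem σ (Finset.mem_univ _) fun τ _ hτ =>
      Set.indicator_of_notMem (fun h => hτ (huniq τ h)) _]
    rw [Set.indicator_of_mem (show y ∈ {y : ι → ℝ | StrictMono (y ∘ σ)} from hσ), hf y σ hpos hσ]
  rw [lintegral_congr_ae hae, lintegral_finsetSum' _ fun σ _ =>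
    (measurable_const.indicator (measurableSet_strictMono _)).aemeasurable,
    finsum_eq_sum_of_fintype]
  refine Finset.sum_congr rfl fun σ _ => ?_
  rw [lintegral_indicator_const (measurableSet_strictMono _)]
  congr 1
  have hmp := measurePreserving_piCongrLeft (fun _ : Fin b => segmentMeasure t) σ.symm
  have hset : {y : ι → ℝ | StrictMono (y ∘ σ)} =
      MeasurableEquiv.piCongrLeft (fun _ : Fin b => ℝ) σ.symm ⁻¹' {y | StrictMono y} := by
    ext y
    have : MeasurableEquiv.piCongrLeft (fun _ : Fin b => ℝ) σ.symm y = y ∘ σ := by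
      funext i
      have := Equiv.piCongrLeft_apply_apply (fun _ : Fin b => ℝ) σ.symm y (σ i)
      rwa [Equiv.symm_apply_apply] at this
    rw [Set.mem_preimage, this]
    rfl
  have hms := measurableSet_strictMono (id : Fin b → Fin b)
  rw [hset]
  exact hmp.measure_preimage hms.nullMeasurableSet

/-- The simplex of increasing points has measure `t ^ b / b!`: its `b!` images under permutations of
the coordinates fill the cube up to a null set. -/
theorem measure_strictMono {t : ℝ} (ht : 0 ≤ t) (b : ℕ) :
    Measure.pi (fun _ : Fin b => segmentMeasure t) {y | StrictMono y} =
      ENNReal.ofReal (t ^ b / b.factorial) := by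
  have h := lintegral_eq_sum_mul t (Equiv.refl (Fin b)) (fun _ => 1) (fun _ => 1)
    fun _ _ _ _ => rfl
  rw [lintegral_one, Measure.pi_univ, finsum_eq_sum_of_fintype] at h
  simp only [Measure.restrict_apply_univ, Real.volume_Icc, sub_zero, Finset.prod_const,
    Finset.card_univ, Fintype.card_fin, one_mul, Finset.sum_const, nsmul_eq_mul,
    Fintype.card_perm] at h
  have hb : (b.factorial : ℝ≥0∞) ≠ 0 := by exact_mod_cast b.factorial_ne_zero
  rw [ENNReal.ofReal_div_of_pos (by positivity), ENNReal.ofReal_pow ht, h, ENNReal.ofReal_natCast,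
    mul_comm, ENNReal.mul_div_cancel_right hb (ENNReal.natCast_ne_top _)]

theorem pqWeight_of_strictMono {ι : Type*} {b : ℕ} (p q : ℝ) {y : ι → ℝ} (hpos : ∀ i, 0 < y i)
    {σ : Fin b ≃ ι} (hσ : StrictMono (y ∘ σ)) {i j : ι} (hij : i ≠ j) :
    pqWeight p q (y i) (y j) = if σ.symm i < σ.symm j then p else q := by
  have h : ∀ i j, y i < y j ↔ σ.symm i < σ.symm j := fun i j => by
    rw [← hσ.lt_iff_lt]; simp
  unfold pqWeight
  simp only [h]
  rcases lt_trichotomy (σ.symm i) (σ.symm j) with hlt | heq | hgt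
  · rw [if_pos ⟨hpos i, hlt⟩, if_pos hlt]
  · exact absurd (σ.symm.injective heq) hij
  · rw [if_neg fun h' => lt_asymm h'.2 hgt, if_pos ⟨hpos j, hgt⟩, if_neg (lt_asymm hgt)]

open Classical in
/-- A product of weights along the edges of a directed graph, integrated over `[0, t]` in each
variable, is a sum over the enumerations of the vertices. -/
theorem lintegral_prod_pqWeight {ι : Type*} [Fintype ι] [DecidableEq ι] {b : ℕ}
    (e : Fin b ≃ ι) {p q : ℝ}
    (hp : 0 ≤ p) (hq : 0 ≤ q) {t : ℝ} (ht : 0 ≤ t) (r : ι → ι → Prop) (hr : ∀ i, ¬ r i i) :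
    ∫⁻ y, ENNReal.ofReal (∏ i, ∏ j, if r i j then pqWeight p q (y i) (y j) else 1)
        ∂Measure.pi (fun _ : ι => segmentMeasure t) =
      ENNReal.ofReal (∑ σ : Fin b ≃ ι, t ^ b / b.factorial *
        ∏ i, ∏ j, if r i j then (if σ.symm i < σ.symm j then p else q) else 1) := by
  have hnn : ∀ σ : Fin b ≃ ι,
      0 ≤ ∏ i, ∏ j, if r i j then (if σ.symm i < σ.symm j then p else q) else (1 : ℝ) := fun σ =>
    Finset.prod_nonneg fun i _ => Finset.prod_nonneg fun j _ => by
      split_ifs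
      · exact hp
      · exact hq
      · exact zero_le_one
  rw [lintegral_eq_sum_mul t e _ (fun σ => ENNReal.ofReal
      (∏ i, ∏ j, if r i j then (if σ.symm i < σ.symm j then p else q) else 1)),
    measure_strictMono ht, finsum_eq_sum_of_fintype,
    ENNReal.ofReal_sum_of_nonneg fun σ _ => mul_nonneg (by positivity) (hnn σ)]
  · refine Finset.sum_congr rfl fun σ _ => ?_
    rw [← ENNReal.ofReal_mul (hnn σ), mul_comm]
  · intro y σ hpos hσ
    have ne_of_rel : ∀ {i j}, r i j → i ≠ j := fun {i j} h hij => hr j (hij ▸ h)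
    congr 1
    refine Finset.prod_congr rfl fun i _ => Finset.prod_congr rfl fun j _ => ?_
    split_ifs with h1 h2
    · rw [pqWeight_of_strictMono p q hpos hσ (ne_of_rel h1), if_pos h2]
    · rw [pqWeight_of_strictMono p q hpos hσ (ne_of_rel h1), if_neg h2]
    · rfl

/-! ### Neighboring blocks and the weights of ordered partitions -/

namespace PartitionOf

variable {n : ℕ}

/-- The first element of a block. -/
def lo (π : PartitionOf n) (A : {A // A ∈ π.parts}) : Fin n :=
  A.1.min' (π.nonempty_of_mem_parts A.2)

/-- The last element of a block. -/
def hi (π : PartitionOf n) (A : {A // A ∈ π.parts}) : Fin n :=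
  A.1.max' (π.nonempty_of_mem_parts A.2)

/-- The block of `i`. -/
def blockOf (π : PartitionOf n) (i : Fin n) : {A // A ∈ π.parts} := ⟨π.part i, π.part_mem i⟩

theorem lo_blockOf (π : PartitionOf n) (i : Fin n) : π.lo (π.blockOf i) = π.first i := rfl

theorem blockOf_of_mem (π : PartitionOf n) {i : Fin n} {A : {A // A ∈ π.parts}} (h : i ∈ A.1) :
    π.blockOf i = A :=
  Subtype.ext (π.part_eq_of_mem A.2 h)

theorem blockOf_lo (π : PartitionOf n) (A : {A // A ∈ π.parts}) : π.blockOf (π.lo A) = A :=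
  π.blockOf_of_mem (Finset.min'_mem _ _)

theorem blockOf_hi (π : PartitionOf n) (A : {A // A ∈ π.parts}) : π.blockOf (π.hi A) = A :=
  π.blockOf_of_mem (Finset.max'_mem _ _)

theorem first_lo (π : PartitionOf n) (A : {A // A ∈ π.parts}) : π.first (π.lo A) = π.lo A := by
  rw [← lo_blockOf, blockOf_lo]

theorem first_hi (π : PartitionOf n) (A : {A // A ∈ π.parts}) : π.first (π.hi A) = π.lo A := by
  rw [← lo_blockOf, blockOf_hi]

theorem lo_le (π : PartitionOf n) {A : {A // A ∈ π.parts}} {i : Fin n} (h : i ∈ A.1) :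
    π.lo A ≤ i := Finset.min'_le _ _ h

theorem le_hi (π : PartitionOf n) {A : {A // A ∈ π.parts}} {i : Fin n} (h : i ∈ A.1) :
    i ≤ π.hi A := Finset.le_max' _ _ h

theorem lo_mem (π : PartitionOf n) (A : {A // A ∈ π.parts}) : π.lo A ∈ A.1 := Finset.min'_mem _ _

theorem hi_mem (π : PartitionOf n) (A : {A // A ∈ π.parts}) : π.hi A ∈ A.1 := Finset.max'_mem _ _

theorem isInner_iff (π : PartitionOf n) (A B : {A // A ∈ π.parts}) :
    IsInner A.1 B.1 ↔ π.lo B < π.lo A ∧ π.hi A < π.hi B := by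
  constructor
  · rintro ⟨-, a, ha, b, hb, h⟩
    exact ⟨(π.lo_le ha).trans_lt (h _ (π.lo_mem A)).1, (h _ (π.hi_mem A)).2.trans_le (π.le_hi hb)⟩
  · rintro ⟨h1, h2⟩
    refine ⟨fun h => ?_, π.lo B, π.lo_mem B, π.hi B, π.hi_mem B, fun c hc =>
      ⟨h1.trans_le (π.lo_le hc), (π.le_hi hc).trans_lt h2⟩⟩
    rw [Subtype.ext h] at h1
    exact lt_irrefl _ h1

/-- A block that starts between the first and the last element of `B` ends before `B` does. -/
theorem IsNonCrossing.hi_lt_hi {π : PartitionOf n} (hπ : π.IsNonCrossing)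
    {B C : {A // A ∈ π.parts}} (h1 : π.lo B < π.lo C) (h2 : π.lo C < π.hi B) :
    π.hi C < π.hi B := by
  have hne : B.1 ≠ C.1 := fun h => by
    rw [Subtype.ext h] at h1
    exact lt_irrefl _ h1
  by_contra! h
  have hne' : π.hi B ≠ π.hi C := fun h' => hne (by
    rw [← π.blockOf_hi B, ← π.blockOf_hi C, h'])
  exact hπ _ B.2 _ C.2 hne ⟨_, π.lo_mem B, _, π.hi_mem B, _, π.lo_mem C, _, π.hi_mem C, h1, h2,
    lt_of_le_of_ne h hne'⟩

/-- The blocks in which a block is contained are those below it on the stack. -/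
theorem IsNonCrossing.mem_active_tail_word {π : PartitionOf n} (hπ : π.IsNonCrossing)
    (A : {A // A ∈ π.parts}) (i : ℕ) :
    i ∈ (active (extendWord π.word) (π.hi A)).tail ↔
      ∃ B, π.lo B = i ∧ IsInner A.1 B.1 := by
  rw [mem_active_tail_iff, hπ.label_word, hπ.mem_active_word, first_hi]
  constructor
  · rintro ⟨⟨h, hle, hopen⟩, hne⟩
    have hlo : π.lo (π.blockOf ⟨i, h⟩) = ⟨i, h⟩ := by rw [lo_blockOf, hopen.1]
    refine ⟨π.blockOf ⟨i, h⟩, by rw [hlo], (π.isInner_iff _ _).2 ⟨?_, ?_⟩⟩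
    · rw [hlo]
      have := hπ.le_first hle hopen
      rw [first_hi] at this
      exact lt_of_le_of_ne this fun h' => hne (by rw [← h'])
    · obtain ⟨-, j, hj, hAj⟩ := hopen
      refine lt_of_le_of_ne (le_trans (show π.hi A ≤ j from hAj)
        (π.le_hi (A := π.blockOf ⟨i, h⟩) hj)) fun h' => hne ?_
      rw [← π.blockOf_hi A, h', blockOf_hi, hlo]
  · rintro ⟨B, rfl, hB⟩
    rw [isInner_iff] at hB
    refine ⟨⟨(π.lo B).2, ?_, π.first_lo B, π.hi B, ?_, hB.2.le⟩, ?_⟩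
    · exact hB.1.le.trans (π.lo_le (π.hi_mem A))
    · change π.hi B ∈ (π.blockOf (π.lo B)).1
      rw [blockOf_lo]
      exact π.hi_mem B
    · exact fun h => hB.1.ne (Fin.ext h)

theorem isInnerNeighbor_irrefl (π : PartitionOf n) (A : Finset (Fin n)) :
    ¬ π.IsInnerNeighbor A A := fun h => h.1.1 rfl

/-- The inner neighbors of a block are the blocks closed while it is second on the stack. -/
theorem IsNonCrossing.isInnerNeighbor_iff {π : PartitionOf n} (hπ : π.IsNonCrossing)
    (A B : {A // A ∈ π.parts}) : π.IsInnerNeighbor A.1 B.1 ↔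
      (active (extendWord π.word) (π.hi A)).tail.head? = some (π.lo B : ℕ) := by
  have hmem := hπ.mem_active_tail_word A
  have hsorted := (active_pairwise (extendWord π.word) (π.hi A)).tail
  cases hL : (active (extendWord π.word) (π.hi A)).tail with
  | nil =>
    simp only [List.head?_nil, reduceCtorEq, iff_false]
    intro h
    have := (hmem (π.lo B)).2 ⟨B, rfl, h.1⟩
    rw [hL] at this
    exact List.not_mem_nil this
  | cons j l =>
    rw [hL] at hmem hsorted
    have hmax : ∀ C : {A // A ∈ π.parts}, IsInner A.1 C.1 → (π.lo C : ℕ) ≤ j := fun C hC => by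
      rcases List.mem_cons.1 ((hmem _).2 ⟨C, rfl, hC⟩) with h | h
      · exact h.le
      · exact le_of_lt (List.rel_of_pairwise_cons hsorted h)
    obtain ⟨D, rfl, hD⟩ := (hmem j).1 List.mem_cons_self
    rw [List.head?_cons, Option.some_inj]
    constructor
    · rintro ⟨h1, h2⟩
      by_contra hne
      have hlt : π.lo B < π.lo D := lt_of_le_of_ne (hmax B h1) fun h => hne (by rw [h])
      refine h2 ⟨D.1, D.2, hD, (π.isInner_iff _ _).2 ⟨hlt, hπ.hi_lt_hi hlt ?_⟩⟩
      rw [isInner_iff] at h1 hD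
      exact hD.1.trans_le ((π.lo_le (π.hi_mem A)).trans h1.2.le)
    · intro h
      obtain rfl : D = B := by rw [← π.blockOf_lo D, Fin.ext h, blockOf_lo]
      refine ⟨hD, fun ⟨C, hC, h1, h2⟩ => ?_⟩
      have := hmax ⟨C, hC⟩ h1
      exact absurd ((π.isInner_iff ⟨C, hC⟩ D).1 h2).1 (not_lt.2 this)

open Classical in
theorem IsNonCrossing.edgeWeight_word {π : PartitionOf n} (hπ : π.IsNonCrossing) (p q : ℝ)
    (A : {A // A ∈ π.parts}) (s : ℕ → ℝ) :
    edgeWeight p q (active (extendWord π.word) (π.hi A)) s =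
      ∏ B : {A // A ∈ π.parts},
        if π.IsInnerNeighbor A.1 B.1 then pqWeight p q (s (π.lo A)) (s (π.lo B)) else 1 := by
  simp only [hπ.isInnerNeighbor_iff]
  have hmem := hπ.mem_active_tail_word A
  rw [active_eq_cons (hπ.admissible_word.1 _ (π.hi A).2), hπ.label_word, first_hi, List.tail_cons]
  cases hL : (active (extendWord π.word) (π.hi A)).tail with
  | nil => simp [edgeWeight]
  | cons j l =>
    rw [hL] at hmem
    obtain ⟨D, rfl, hD⟩ := (hmem j).1 List.mem_cons_self
    rw [Finset.prod_eq_single_of_mem D (Finset.mem_univ _)]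
    · simp [edgeWeight]
    · intro B _ hB
      refine if_neg fun h => hB ?_
      rw [List.head?_cons, Option.some_inj] at h
      rw [← π.blockOf_lo D, Fin.ext h, blockOf_lo]

open Classical in
/-- The weight of the word of a non-crossing partition is a product over all pairs of neighboring
blocks. -/
theorem IsNonCrossing.wordWeight_word {π : PartitionOf n} (hπ : π.IsNonCrossing) (p q : ℝ)
    (s : ℕ → ℝ) : wordWeight p q (extendWord π.word) n s =
      ∏ A : {A // A ∈ π.parts}, ∏ B : {A // A ∈ π.parts},
        if π.IsInnerNeighbor A.1 B.1 then pqWeight p q (s (π.lo A)) (s (π.lo B)) else 1 := by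
  simp only [← hπ.edgeWeight_word]
  rw [wordWeight, Finset.prod_range, ← Finset.prod_filter]
  refine Finset.prod_bij' (fun k _ => π.blockOf k) (fun A _ => π.hi A)
    (fun k _ => Finset.mem_univ _) (fun A _ => ?_) (fun k hk => ?_) (fun A _ => π.blockOf_hi A)
    (fun k hk => ?_)
  · rw [Finset.mem_filter, extendWord_coe, word_snd]
    refine ⟨Finset.mem_univ _, fun j hj => ?_⟩
    change j ∈ (π.blockOf (π.hi A)).1 at hj
    rw [blockOf_hi] at hj
    exact π.le_hi hj
  · rw [Finset.mem_filter, extendWord_coe, word_snd] at hk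
    exact le_antisymm (hk.2 _ (π.hi_mem (π.blockOf k))) (π.le_hi (π.mem_part_self k))
  · rw [Finset.mem_filter, extendWord_coe, word_snd] at hk
    have : π.hi (π.blockOf k) = k :=
      le_antisymm (hk.2 _ (π.hi_mem (π.blockOf k))) (π.le_hi (π.mem_part_self k))
    rw [this]

/-- The blocks of a partition correspond to the openings in its word. -/
def blockEquiv (π : PartitionOf n) :
    {A // A ∈ π.parts} ≃ openings (extendWord π.word) n where
  toFun A := ⟨π.lo A, by
    refine Finset.mem_filter.2 ⟨Finset.mem_range.2 (π.lo A).2, ?_⟩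
    rw [extendWord_coe, word_fst, first_lo]⟩
  invFun i := π.blockOf ⟨i, Finset.mem_range.1 (Finset.mem_filter.1 i.2).1⟩
  left_inv A := π.blockOf_lo A
  right_inv i := by
    obtain ⟨i, hi⟩ := i
    obtain ⟨h1, h2⟩ := Finset.mem_filter.1 hi
    have h3 := extendWord_coe π.word ⟨i, Finset.mem_range.1 h1⟩
    change extendWord π.word i = _ at h3
    rw [h3, word_fst] at h2
    exact Subtype.ext (congrArg Fin.val h2)

theorem coe_blockEquiv (π : PartitionOf n) (A : {A // A ∈ π.parts}) :
    (π.blockEquiv A : ℕ) = π.lo A := rfl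

end PartitionOf

namespace OrderedPartition

variable {n : ℕ}

open Classical in
/-- The weight of an ordered partition as a product over the pairs of neighboring blocks. -/
theorem weight_eq_prod (p q : ℝ) (P : OrderedPartition n) :
    P.weight p q = ∏ A : {A // A ∈ P.1.parts}, ∏ B : {A // A ∈ P.1.parts},
      if P.1.IsInnerNeighbor A.1 B.1 then (if P.2.symm A < P.2.symm B then p else q) else 1 := by
  have h : ∀ A B : {A // A ∈ P.1.parts},
      (if P.1.IsInnerNeighbor A.1 B.1 then (if P.2.symm A < P.2.symm B then p else q) else 1) =
      (if P.2.symm A < P.2.symm B ∧ P.1.IsInnerNeighbor A.1 B.1 then p else 1) *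
      (if P.2.symm B < P.2.symm A ∧ P.1.IsInnerNeighbor A.1 B.1 then q else 1) := by
    intro A B
    by_cases hAB : P.1.IsInnerNeighbor A.1 B.1
    · have hne : P.2.symm A ≠ P.2.symm B := fun h =>
        hAB.1.1 (congrArg Subtype.val (P.2.symm.injective h))
      rcases hne.lt_or_gt with hlt | hlt
      · simp [hAB, hlt, lt_asymm hlt]
      · simp [hAB, hlt, lt_asymm hlt]
    · simp [hAB]
  simp only [h, Finset.prod_mul_distrib]
  unfold weight disorders orders block
  congr 1
  · rw [← P.2.prod_comp, ← Finset.prod_const, Finset.prod_filter, ← Finset.univ_product_univ,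
      Finset.prod_product]
    refine Finset.prod_congr rfl fun i _ => ?_
    rw [← P.2.prod_comp]
    simp only [Equiv.symm_apply_apply]
  · rw [Finset.prod_comm, ← P.2.prod_comp, ← Finset.prod_const, Finset.prod_filter,
      ← Finset.univ_product_univ, Finset.prod_product]
    refine Finset.prod_congr rfl fun i _ => ?_
    rw [← P.2.prod_comp]
    simp only [Equiv.symm_apply_apply]

end OrderedPartition

/-- The contribution of a single non-crossing partition to the moments. -/
theorem PartitionOf.IsNonCrossing.lmarginal_word {n : ℕ} {π : PartitionOf n}
    (hπ : π.IsNonCrossing) {p q : ℝ} (hp : 0 ≤ p) (hq : 0 ≤ q) {t : ℝ} (ht : 0 ≤ t)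
    (s : ℕ → ℝ) : ((∫⋯∫⁻_(openings (extendWord π.word) n),
      (fun s => ENNReal.ofReal (wordWeight p q (extendWord π.word) n s))
        ∂fun _ => segmentMeasure t) s).toReal =
      ∑ σ : Fin π.parts.card ≃ {A // A ∈ π.parts},
        t ^ π.parts.card / (π.parts.card.factorial : ℝ) *
          OrderedPartition.weight p q ⟨π, σ⟩ := by
  classical
  set e := π.blockEquiv with he
  have hcard : Fintype.card {A // A ∈ π.parts} = π.parts.card := Fintype.card_coe _
  have hfun : ∀ y : openings (extendWord π.word) n → ℝ,
      wordWeight p q (extendWord π.word) n (Function.updateFinset s _ y) =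
      ∏ i, ∏ j, if π.IsInnerNeighbor (e.symm i).1 (e.symm j).1 then
        pqWeight p q (y i) (y j) else 1 := fun y => by
    have hy : ∀ A,
        Function.updateFinset s (openings (extendWord π.word) n) y (π.lo A) = y (e A) := by
      intro A
      rw [← π.coe_blockEquiv, Function.updateFinset, dif_pos (π.blockEquiv A).2]
    rw [hπ.wordWeight_word, ← e.prod_comp]
    refine Finset.prod_congr rfl fun A _ => ?_
    rw [← e.prod_comp]
    refine Finset.prod_congr rfl fun B _ => ?_
    rw [hy, hy, e.symm_apply_apply, e.symm_apply_apply]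
  unfold lmarginal
  simp only [hfun]
  rw [lintegral_prod_pqWeight ((Fintype.equivFinOfCardEq hcard).symm.trans e) hp hq ht
    (fun i j => π.IsInnerNeighbor (e.symm i).1 (e.symm j).1)
    fun i => π.isInnerNeighbor_irrefl _, ENNReal.toReal_ofReal]
  · refine (Fintype.sum_equiv (Equiv.equivCongr (Equiv.refl (Fin π.parts.card)) e) _ _
      fun σ => ?_).symm
    rw [OrderedPartition.weight_eq_prod]
    congr 1
    refine Fintype.prod_equiv e _ _ fun A => Fintype.prod_equiv e _ _ fun B => ?_
    simp [Equiv.equivCongr]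
  · refine Finset.sum_nonneg fun σ _ => mul_nonneg (by positivity) ?_
    refine Finset.prod_nonneg fun i _ => Finset.prod_nonneg fun j _ => ?_
    split_ifs
    · exact hp
    · exact hq
    · exact zero_le_one

theorem sum_ONC {n : ℕ} (f : OrderedPartition n → ℝ) :
    ∑ P ∈ ONC n, f P = ∑ π ∈ NC n, ∑ σ, f ⟨π, σ⟩ := by
  classical
  rw [← Finset.sum_sigma (NC n) (fun _ => Finset.univ) f]
  refine Finset.sum_congr ?_ fun _ _ => rfl
  ext P
  simp [ONC, NC]

theorem vacuumState_pqPoisson_pow_eq_sum_ONC {p q : ℝ} (hp : 0 ≤ p) (hq : 0 ≤ q) {t : ℝ}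
    (ht : 0 ≤ t) (n : ℕ) : vacuumState (pqPoisson p q t ^ n) =
      ((∑ P ∈ ONC n, t ^ P.numBlocks / (P.numBlocks.factorial : ℝ) * P.weight p q : ℝ) : ℂ) := by
  rw [vacuumState_pqPoisson_pow hp hq t n 0, sum_ONC]
  congr 1
  exact Finset.sum_congr rfl fun π hπ =>
    (PartitionOf.mem_NC.1 hπ).lmarginal_word hp hq ht 0

/-! ### The free and the monotone case -/

theorem Coupling.creation_congr {k l : Coupling} (h : ∀ s t, k.toFun s t = l.toFun s t)
    (f : OneParticle) : k.creation f = l.creation f := by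
  obtain ⟨k, _, _⟩ := k
  obtain ⟨l, _, _⟩ := l
  obtain rfl : k = l := funext fun s => funext fun t => h s t
  rfl

theorem pqCreation_one_one (f : OneParticle) : pqCreation 1 1 f = freeCreation f :=
  Coupling.creation_congr (fun s t => by simp [pqCoupling, pqWeight]) f

theorem pqPoisson_one_one (t : ℝ) : pqPoisson 1 1 t = freePoisson t := by
  rw [pqPoisson, freePoisson, pqCreation_one_one]

theorem sum_ONC_div_factorial (t : ℝ) (n : ℕ) :
    ∑ P ∈ ONC n, t ^ P.numBlocks / (P.numBlocks.factorial : ℝ) * P.weight 1 1 =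
      ∑ π ∈ NC n, t ^ π.parts.card := by
  rw [sum_ONC]
  refine Finset.sum_congr rfl fun π _ => ?_
  have e : Fin π.parts.card ≃ {A // A ∈ π.parts} :=
    (Fintype.equivFinOfCardEq (Fintype.card_coe _)).symm
  have h : (π.parts.card.factorial : ℝ) ≠ 0 := by exact_mod_cast π.parts.card.factorial_ne_zero
  simp only [OrderedPartition.weight, OrderedPartition.numBlocks, one_pow, mul_one,
    Finset.sum_const, Finset.card_univ, Fintype.card_equiv e, Fintype.card_fin, nsmul_eq_mul]
  rw [mul_div_cancel₀ _ h]

namespace OrderedPartition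

/-- Since containment of blocks is the transitive closure of the neighbor relation, an ordered
partition is monotone as soon as it has no disorders. -/
theorem disorders_eq_zero_iff {n : ℕ} (P : OrderedPartition n) :
    P.disorders = 0 ↔ P.IsMonotone := by
  classical
  unfold disorders
  rw [Finset.card_eq_zero, Finset.filter_eq_empty_iff]
  have hinner : ∀ i j, IsInner (P.block i) (P.block j) ↔
      P.1.lo (P.2 j) < P.1.lo (P.2 i) ∧ P.1.hi (P.2 i) < P.1.hi (P.2 j) := fun i j =>
    P.1.isInner_iff _ _
  constructor
  · intro h
    -- induction on the difference of the first elements of the two blocks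
    have key : ∀ (d : ℕ) (i j), (P.1.lo (P.2 j) : ℕ) - P.1.lo (P.2 i) = d →
        IsInner (P.block j) (P.block i) → i < j := by
      intro d
      induction d using Nat.strong_induction_on with
      | _ d ih =>
        intro i j hd hij
        by_cases hC : ∃ C ∈ P.1.parts, IsInner (P.block j) C ∧ IsInner C (P.block i)
        · obtain ⟨C, hC, h1, h2⟩ := hC
          obtain ⟨k, hk⟩ := P.2.surjective ⟨C, hC⟩
          have hk' : P.block k = C := congrArg Subtype.val hk
          rw [← hk'] at h1 h2
          have hlt1 : (P.1.lo (P.2 k) : ℕ) < P.1.lo (P.2 j) := ((hinner _ _).1 h1).1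
          have hlt2 : (P.1.lo (P.2 i) : ℕ) < P.1.lo (P.2 k) := ((hinner _ _).1 h2).1
          exact (ih _ (by omega) i k rfl h2).trans (ih _ (by omega) k j rfl h1)
        · have hne : i ≠ j := fun h => hij.1 (by rw [h])
          exact hne.lt_of_le (not_lt.1 fun hlt => h (Finset.mem_univ (j, i)) ⟨hlt, hij, hC⟩)
    exact fun i j => key _ i j rfl
  · rintro h ⟨i, j⟩ - ⟨hlt, hij⟩
    exact lt_asymm hlt (h j i hij.1)

end OrderedPartition

theorem sum_ONC_weight_zero_one (t : ℝ) (n : ℕ) :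
    ∑ P ∈ ONC n, t ^ P.numBlocks / (P.numBlocks.factorial : ℝ) * P.weight 0 1 =
      ∑ P ∈ MNC n, t ^ P.numBlocks / (P.numBlocks.factorial : ℝ) := by
  classical
  have h : MNC n = (ONC n).filter fun P => P.IsMonotone := by
    ext P
    simp [MNC, ONC]
  rw [h, Finset.sum_filter]
  refine Finset.sum_congr rfl fun P _ => ?_
  rw [OrderedPartition.weight, one_pow, mul_one, zero_pow_eq]
  simp only [P.disorders_eq_zero_iff, mul_ite, mul_one, mul_zero]

theorem FockMultiplier.op_mul_comm (g h : FockMultiplier) : g.op * h.op = h.op * g.op := by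
  refine ContinuousLinearMap.ext fun F => ?_
  ext1
  funext n
  change g.component n (h.component n (F n)) = h.component n (g.component n (F n))
  refine Lp.ext ?_
  filter_upwards [g.coeFn_component n (h.component n (F n)), h.coeFn_component n (F n),
    h.coeFn_component n (g.component n (F n)), g.coeFn_component n (F n)] with x h1 h2 h3 h4
  rw [h1, h2, h3, h4]
  ring

theorem simplexMultiplier_apply (n : ℕ) (x : Fin n → ℝ) [Decidable (∀ i j, i < j → x j < x i)] :
    simplexMultiplier.toFun n x = if ∀ i j, i < j → x j < x i then 1 else 0 := by
  simp only [simplexMultiplier, Set.indicator_apply, Set.mem_ofPred_eq, Pi.one_apply]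
  congr

theorem monotoneProj_mul_self : monotoneProj * monotoneProj = monotoneProj := by
  classical
  refine ContinuousLinearMap.ext fun F => ?_
  ext1
  funext n
  change simplexMultiplier.component n (simplexMultiplier.component n (F n)) =
    simplexMultiplier.component n (F n)
  refine Lp.ext ?_
  filter_upwards [simplexMultiplier.coeFn_component n (simplexMultiplier.component n (F n)),
    simplexMultiplier.coeFn_component n (F n)] with x h1 h2
  rw [h1, h2, simplexMultiplier_apply]
  split_ifs <;> simp

theorem monotoneProj_vacuum : monotoneProj vacuum = vacuum := by
  classical
  unfold monotoneProj
  rw [FockMultiplier.op_vacuum _ 1 fun x => by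
    rw [simplexMultiplier_apply, if_pos fun i => i.elim0]]
  simp

theorem ae_rayMeasure_pos : ∀ᵐ x ∂rayMeasure, 0 < x := by
  have h0 : ∀ᵐ x ∂rayMeasure, x ≠ 0 := Measure.ae_ne _ 0
  filter_upwards [ae_restrict_mem measurableSet_Ici, h0] with x hx h
  exact lt_of_le_of_ne hx (Ne.symm h)

theorem tail_mem_simplex {n : ℕ} {x : Fin (n + 1) → ℝ} (h : ∀ i j, i < j → x j < x i) :
    ∀ i j : Fin n, i < j → Fin.tail x j < Fin.tail x i :=
  fun _ _ hij => h _ _ (Fin.succ_lt_succ_iff.2 hij)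

/-- On the simplex the coupling for `(p, q) = (0, 1)` equals `1`. -/
theorem factor_zero_one_of_mem {n : ℕ} {x : Fin (n + 1) → ℝ} (h : ∀ i j, i < j → x j < x i) :
    (pqCoupling 0 1).factor n x = 1 := by
  cases n with
  | zero => rfl
  | succ n =>
    have h01 : x 1 < x 0 := h 0 1 (Fin.mk_lt_mk.2 (by simp))
    simp [Coupling.factor, pqCoupling, pqWeight, lt_asymm h01]

/-- If only the tail of `x` lies in the simplex, then the coupling for `(p, q) = (0, 1)` vanishes,
apart from the null set of points with a negative, zero, or repeated coordinate. -/
theorem factor_zero_one_of_not_mem {n : ℕ} {x : Fin (n + 1) → ℝ} (hpos : ∀ i, 0 < x i)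
    (hinj : Function.Injective x)
    (htail : ∀ i j : Fin n, i < j → Fin.tail x j < Fin.tail x i)
    (h : ¬ ∀ i j, i < j → x j < x i) : (pqCoupling 0 1).factor n x = 0 := by
  cases n with
  | zero => exact absurd (fun i j hij => absurd hij (by omega)) h
  | succ n =>
    have h10 : x 0 < x 1 := by
      by_contra! hle
      have hlt : x 1 < x 0 := lt_of_le_of_ne hle (hinj.ne (by simp))
      refine h fun i j hij => ?_
      obtain ⟨j, rfl⟩ := Fin.exists_succ_eq.2
        (Fin.pos_iff_ne_zero.1 (lt_of_le_of_lt (Fin.zero_le i) hij))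
      rcases Fin.eq_zero_or_eq_succ i with rfl | ⟨i, rfl⟩
      · rcases Fin.eq_zero_or_eq_succ j with rfl | ⟨j, rfl⟩
        · exact hlt
        · exact (htail 0 j.succ (Fin.succ_pos j)).trans hlt
      · exact htail i j (Fin.succ_lt_succ_iff.1 hij)
    simp [Coupling.factor, pqCoupling, pqWeight, hpos, h10]

/-- `Q a(f) = d(f)`: on the simplex the coupling is `1`. -/
theorem monotoneProj_mul_creation (f : OneParticle) :
    monotoneProj * pqCreation 0 1 f = monotoneCreation f := by
  classical
  refine ContinuousLinearMap.ext fun F => ?_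
  ext1
  funext n
  cases n with
  | zero => rfl
  | succ n =>
    set l : Coupling := ⟨fun _ _ => 1, measurable_const, 1, fun _ _ => by simp⟩
    change simplexMultiplier.component (n + 1) ((pqCoupling 0 1).component f n (F n)) =
      simplexMultiplier.component (n + 1) (l.component f n (simplexMultiplier.component n (F n)))
    have hl : ∀ x, l.factor n x = 1 := fun x => by cases n <;> rfl
    refine Lp.ext ?_
    filter_upwards [
      simplexMultiplier.coeFn_component (n + 1) ((pqCoupling 0 1).component f n (F n)),
      (pqCoupling 0 1).coeFn_component f n (F n),
      simplexMultiplier.coeFn_component (n + 1)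
        (l.component f n (simplexMultiplier.component n (F n))),
      l.coeFn_component f n (simplexMultiplier.component n (F n)),
      ae_tail (simplexMultiplier.coeFn_component n (F n))] with x h1 h2 h3 h4 h5
    rw [h1, h2, h3, h4, h5, hl, simplexMultiplier_apply, simplexMultiplier_apply]
    by_cases h : ∀ i j, i < j → x j < x i
    · rw [if_pos h, if_pos (tail_mem_simplex h), factor_zero_one_of_mem h]
      simp
    · rw [if_neg h]
      simp

/-- `a(f) Q = d(f)`: for `(p, q) = (0, 1)` the creation operator preserves the monotone Fock space,
as its coupling vanishes almost everywhere off the simplex. -/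
theorem creation_mul_monotoneProj (f : OneParticle) :
    pqCreation 0 1 f * monotoneProj = monotoneCreation f := by
  classical
  refine ContinuousLinearMap.ext fun F => ?_
  ext1
  funext n
  cases n with
  | zero => exact (map_zero (simplexMultiplier.component 0)).symm
  | succ n =>
    set l : Coupling := ⟨fun _ _ => 1, measurable_const, 1, fun _ _ => by simp⟩
    change (pqCoupling 0 1).component f n (simplexMultiplier.component n (F n)) =
      simplexMultiplier.component (n + 1) (l.component f n (simplexMultiplier.component n (F n)))
    have hl : ∀ x, l.factor n x = 1 := fun x => by cases n <;> rfl
    refine Lp.ext ?_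
    filter_upwards [
      (pqCoupling 0 1).coeFn_component f n (simplexMultiplier.component n (F n)),
      simplexMultiplier.coeFn_component (n + 1)
        (l.component f n (simplexMultiplier.component n (F n))),
      l.coeFn_component f n (simplexMultiplier.component n (F n)),
      ae_tail (simplexMultiplier.coeFn_component n (F n)),
      ae_injective_pi_restrict (ι := Fin (n + 1)) (Set.Ici 0),
      ae_pi_of_ae (ι := Fin (n + 1)) ae_rayMeasure_pos] with x h1 h3 h4 h5 hinj hpos
    rw [h1, h3, h4, h5, hl, simplexMultiplier_apply, simplexMultiplier_apply]
    by_cases h : ∀ i j, i < j → x j < x i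
    · rw [if_pos h, if_pos (tail_mem_simplex h), factor_zero_one_of_mem h]
      simp
    · rw [if_neg h]
      by_cases htail : ∀ i j : Fin n, i < j → Fin.tail x j < Fin.tail x i
      · rw [factor_zero_one_of_not_mem hpos hinj htail h]
        simp
      · rw [if_neg htail]
        simp

theorem adjoint_creation_mul_monotoneProj (f : OneParticle) :
    ContinuousLinearMap.adjoint (pqCreation 0 1 f) * monotoneProj =
      ContinuousLinearMap.adjoint (monotoneCreation f) := by
  rw [← monotoneProj_mul_creation, ContinuousLinearMap.mul_def, ContinuousLinearMap.mul_def,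
    ContinuousLinearMap.adjoint_comp, monotoneProj, FockMultiplier.adjoint_op]

theorem monotoneProj_mul_monotoneCreation (f : OneParticle) :
    monotoneProj * monotoneCreation f = monotoneCreation f := by
  rw [monotoneCreation, ← mul_assoc, ← mul_assoc, monotoneProj_mul_self]

theorem monotoneProj_mul_adjoint (f : OneParticle) :
    monotoneProj * ContinuousLinearMap.adjoint (monotoneCreation f) =
      ContinuousLinearMap.adjoint (monotoneCreation f) := by
  have h : monotoneCreation f * monotoneProj = monotoneCreation f := by
    rw [monotoneCreation, mul_assoc, monotoneProj_mul_self]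
  have h2 := congrArg ContinuousLinearMap.adjoint h
  rw [ContinuousLinearMap.mul_def, ContinuousLinearMap.adjoint_comp, monotoneProj,
    FockMultiplier.adjoint_op] at h2
  exact h2

theorem pqPoisson_mul_monotoneProj (t : ℝ) :
    pqPoisson 0 1 t * monotoneProj = monotonePoisson t := by
  unfold pqPoisson monotonePoisson
  rw [add_mul, add_mul, add_mul, creation_mul_monotoneProj, adjoint_creation_mul_monotoneProj,
    mul_assoc, creation_mul_monotoneProj]
  congr 2
  -- `a^* d = a^* Q d = d^* d`
  rw [← adjoint_creation_mul_monotoneProj, mul_assoc, monotoneProj_mul_monotoneCreation]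

theorem monotoneProj_mul_monotonePoisson (t : ℝ) :
    monotoneProj * monotonePoisson t = monotonePoisson t := by
  have h : monotoneProj * gaugeOp t = gaugeOp t * monotoneProj := FockMultiplier.op_mul_comm _ _
  unfold monotonePoisson
  rw [mul_add, mul_add, mul_add, monotoneProj_mul_monotoneCreation, monotoneProj_mul_adjoint,
    ← mul_assoc, monotoneProj_mul_adjoint, ← mul_assoc, h, mul_assoc, monotoneProj_mul_self]

/-- The vacuum orbits of the two processes agree, since both stay in the monotone Fock space. -/
theorem pqPoisson_zero_one_pow_vacuum (t : ℝ) (n : ℕ) :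
    (pqPoisson 0 1 t ^ n) vacuum = (monotonePoisson t ^ n) vacuum ∧
      monotoneProj ((monotonePoisson t ^ n) vacuum) = (monotonePoisson t ^ n) vacuum := by
  induction n with
  | zero => exact ⟨rfl, monotoneProj_vacuum⟩
  | succ n ih =>
    constructor
    · rw [pow_succ', pow_succ', mul_apply_eq_comp, mul_apply_eq_comp, ih.1,
        ← pqPoisson_mul_monotoneProj, mul_apply_eq_comp, pqPoisson_mul_monotoneProj, ih.2]
    · rw [pow_succ', ← mul_apply_eq_comp monotoneProj, ← mul_assoc,
        monotoneProj_mul_monotonePoisson]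

theorem theorem5p1 :
    (∀ p q : ℝ, 0 ≤ p → 0 ≤ q → ∀ t : ℝ, 0 ≤ t →
      vacuumState (pqPoisson p q t ^ 0) = 1 ∧
      ∀ n : ℕ, vacuumState (pqPoisson p q t ^ n) =
        ((∑ P ∈ ONC n, t ^ P.numBlocks / (P.numBlocks.factorial : ℝ) * P.weight p q : ℝ) : ℂ)) ∧
    (∀ t : ℝ, 0 ≤ t →
      pqPoisson 1 1 t = freePoisson t ∧
      ∀ n : ℕ, vacuumState (freePoisson t ^ n) =
        ((∑ π ∈ NC n, t ^ π.parts.card : ℝ) : ℂ)) ∧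
    (∀ t : ℝ, 0 ≤ t →
      pqPoisson 0 1 t * monotoneProj = monotonePoisson t ∧
      (∀ n : ℕ, vacuumState (pqPoisson 0 1 t ^ n) = vacuumState (monotonePoisson t ^ n)) ∧
      ∀ n : ℕ, vacuumState (monotonePoisson t ^ n) =
        ((∑ P ∈ MNC n, t ^ P.numBlocks / (P.numBlocks.factorial : ℝ) : ℝ) : ℂ)) := by
  have hmono : ∀ t n, vacuumState (pqPoisson 0 1 t ^ n) = vacuumState (monotonePoisson t ^ n) :=
    fun t n => by rw [vacuumState, vacuumState, (pqPoisson_zero_one_pow_vacuum t n).1]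
  refine ⟨fun p q hp hq t ht => ⟨inner_vacuum_self, fun n =>
    vacuumState_pqPoisson_pow_eq_sum_ONC hp hq ht n⟩,
    fun t ht => ⟨pqPoisson_one_one t, fun n => ?_⟩,
    fun t ht => ⟨pqPoisson_mul_monotoneProj t, hmono t, fun n => ?_⟩⟩
  · rw [← pqPoisson_one_one, vacuumState_pqPoisson_pow_eq_sum_ONC zero_le_one zero_le_one ht,
      sum_ONC_div_factorial]
  · rw [← hmono, vacuumState_pqPoisson_pow_eq_sum_ONC le_rfl zero_le_one ht,
      sum_ONC_weight_zero_one]
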